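/- Let $K$ be a field. A \emph{DGA-module} is a chain complex $M=(M_p)_{p\in\mathbb Z}$ of $K$-vector spaces (differential of degree $-1$) together with chain maps $\varepsilon:M\to K$ (augmentation) and $\eta:K\to M$ (coaugmentation) with $\varepsilon\eta=1_K$, where $K$ sits in degree $0$; morphisms of DGA-modules are chain maps commuting with $\varepsilon$ and $\eta$, and tensor products follow the Koszul sign rule. Let $\mathbb S\text{-Mod}$ be the category of families $\{M(n)\}_{n\ge 0}$ of DGA-modules with right DGA-actions $M(n)\otimes K[\Sigma_n]\to M(n)$ (here $K[\Sigma_n]$ is concentrated in degree $0$, augmented by $\sigma\mapsto 1$ and coaugmented by its unit), with equivariant morphisms. Let $\mathcal{OP}$ be the category of symmetric operads in DGA-modules in the sense of May: $\mathbb S$-modules $P$ with a unit $K\to P(1)$ and compositions $\gamma:P(h)\otimes P(i_1)\otimes\cdots\otimes P(i_h)\to P(i_1+\cdots+i_h)$ that are morphisms of DGA-modules and satisfy associativity, the unit laws and the two equivariance conditions; morphisms preserve all this structure. Let $U:\mathcal{OP}\to\mathbb S\text{-Mod}$ be the forgetful functor. Then $\mathcal{OP}$ has all small colimits. More precisely: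 $\mathbb S\text{-Mod}$ has all small colimits, $U$ has a left adjoint, and for every left adjoint $F$ of $U$, with unit $\eta$ and counit $\epsilon$, and every small diagram $\{P_i\}_{i\in I}$ in $\mathcal{OP}$ (in particular every small family), the following holds. Let $\alpha_i:U(P_i)\to\operatorname{colim}_i U(P_i)$ be a colimit cocone in $\mathbb S\text{-Mod}$, and let $$d_0,d_1:F\bigl(\operatorname{colim}_i UFU(P_i)\bigr)\rightrightarrows F\bigl(\operatorname{colim}_i U(P_i)\bigr)$$ be the morphisms of operads adjoint to the morphisms $\operatorname{colim}_i UFU(P_i)\to UF(\operatorname{colim}_i U(P_i))$ whose components are $UF(\alpha_i)$ and $\eta\circ\alpha_i\circ U(\epsilon_{P_i})$, respectively. Let $s=F(\beta)$, where $\beta:\operatorname{colim}_i U(P_i)\to\operatorname{colim}_i UFU(P_i)$ is induced by the units $\eta_{U(P_i)}$. Then $d_0s=d_1s=1$, so that $(d_0,d_1)$ is a reflexive pair; the coequalizer of $d_0$ and $d_1$ exists in $\mathcal{OP}$; and for every coequalizer $q:F(\operatorname{colim}_i U(P_i))\to Q$ of $d_0$ and $d_1$ there are morphisms of operads $f_i:P_i\to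 Q$ with $U(f_i)=U(q)\circ\eta\circ\alpha_i$, and they form a colimit cocone that exhibits $Q$ as the colimit of the $P_i$ in $\mathcal{OP}$. -/

import Mathlib

open CategoryTheory CategoryTheory.Limits

universe u v₁ v₂ u₁ u₂

/-! ### DGA-modules

A DG-module over a field `K` is a chain complex of `K`-modules indexed by `ℤ`
(differential of degree `-1`).  A DGA-module is a DG-module with an augmentation and a
coaugmentation; a morphism of DGA-modules is a morphism of DG-modules that commutes with the
augmentations and the coaugmentations. -/

/-- A differential graded module with augmentation `ε : M → K` and coaugmentation `η : K → M`
such that `ε ∘ η = 1`; here `K` is concentrated in degree `0`. -/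
structure DGAModule (K : Type u) [Field K] where
  /-- the underlying DG-module -/
  cx : ChainComplex (ModuleCat.{u} K) ℤ
  /-- the augmentation, degree by degree -/
  aug : ∀ p : ℤ, cx.X p →ₗ[K] K
  /-- the coaugmentation, which lands in degree `0` -/
  coaug : K →ₗ[K] cx.X 0
  aug_eq_zero : ∀ (p : ℤ), p ≠ 0 → aug p = 0
  aug_d : ∀ (p p' : ℤ) (x : cx.X p), aug p' ((cx.d p p').hom x) = 0
  d_coaug : ∀ (p : ℤ) (a : K), (cx.d 0 p).hom (coaug a) = 0
  aug_coaug : ∀ a : K, aug 0 (coaug a) = a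

namespace DGAModule

variable {K : Type u} [Field K]

/-- Morphisms of DGA-modules. -/
@[ext]
structure Hom (M N : DGAModule K) where
  /-- the underlying morphism of DG-modules -/
  f : M.cx ⟶ N.cx
  aug_comp : ∀ (p : ℤ) (x : M.cx.X p), N.aug p ((f.f p).hom x) = M.aug p x
  comp_coaug : ∀ a : K, (f.f 0).hom (M.coaug a) = N.coaug a

instance : Category (DGAModule K) where
  Hom M N := Hom M N
  id M := { f := 𝟙 _, aug_comp := by simp, comp_coaug := by simp }
  comp f g :=
    { f := f.f ≫ g.f
      aug_comp := by intro p x; simp [f.aug_comp, g.aug_comp]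
      comp_coaug := by intro a; simp [f.comp_coaug, g.comp_coaug] }

@[simp] lemma id_f (M : DGAModule K) : Hom.f (𝟙 M) = 𝟙 M.cx := rfl

@[simp] lemma comp_f {M N L : DGAModule K} (f : M ⟶ N) (g : N ⟶ L) :
    Hom.f (f ≫ g) = Hom.f f ≫ Hom.f g := rfl

@[ext] lemma hom_ext {M N : DGAModule K} (f g : M ⟶ N) (h : Hom.f f = Hom.f g) : f = g :=
  Hom.ext h

/-- The value of a morphism of DGA-modules on an element of degree `p`. -/
def ev {M N : DGAModule K} (f : M ⟶ N) (p : ℤ) : M.cx.X p →ₗ[K] N.cx.X p :=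
  ((Hom.f f).f p).hom

/-- The field `K` as a DGA-module concentrated in degree `0`. -/
noncomputable def ground (K : Type u) [Field K] : DGAModule K where
  cx := (HomologicalComplex.single (ModuleCat.{u} K) (ComplexShape.down ℤ) 0).obj
    (ModuleCat.of K K)
  aug p := if h : p = 0 then
      (HomologicalComplex.XIsoOfEq _ h ≪≫
        HomologicalComplex.singleObjXSelf (ComplexShape.down ℤ) 0 (ModuleCat.of K K)).hom.hom
    else 0
  coaug :=
    (HomologicalComplex.singleObjXSelf (ComplexShape.down ℤ) 0 (ModuleCat.of K K)).inv.hom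
  aug_eq_zero p hp := by simp [hp]
  aug_d p p' x := by simp
  d_coaug p a := by simp
  aug_coaug a := by
    simp only [dif_pos]
    change ((HomologicalComplex.singleObjXSelf (ComplexShape.down ℤ) 0 (ModuleCat.of K K)).inv ≫
      (HomologicalComplex.XIsoOfEq _ rfl ≪≫ HomologicalComplex.singleObjXSelf
        (ComplexShape.down ℤ) 0 (ModuleCat.of K K)).hom).hom a = a
    simp

end DGAModule

/-! ### DGA-morphisms out of a tensor product -/

section TensorHom

variable {K : Type u} [Field K]

lemma sum_update_degree {h : ℕ} (q : Fin h → ℤ) (j : Fin h) {p t : ℤ} (ht : p + ∑ k, q k = t) :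
    p + ∑ k, Function.update q j (q j - 1) k = t - 1 := by
  rw [Finset.sum_update_of_mem (Finset.mem_univ j), ← ht,
    ← Finset.add_sum_erase Finset.univ q (Finset.mem_univ j), Finset.sdiff_singleton_eq_erase]
  ring

/-- From a family `y_1, …, y_h` of homogeneous elements of degrees `q_1, …, q_h`, the family
`y_1, …, d y_j, …, y_h`, of degrees `q_1, …, q_j - 1, …, q_h`. -/
noncomputable def dAt {h : ℕ} (B : Fin h → ChainComplex (ModuleCat.{u} K) ℤ) {q : Fin h → ℤ}
    (y : ∀ k, (B k).X (q k)) (j : Fin h) :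
    ∀ k, (B k).X (Function.update q j (q j - 1) k) := fun k =>
  if hk : k = j then ((B k).d (q k) _).hom (y k)
  else ((B k).XIsoOfEq (Function.update_of_ne hk (q j - 1) q).symm).hom.hom (y k)

/-- A morphism of DGA-modules `A ⊗ B_1 ⊗ ⋯ ⊗ B_h → C`, given as a graded multilinear map.
The differential of the tensor product carries the Koszul signs, its augmentation is
`ε ⊗ ⋯ ⊗ ε` and its coaugmentation is `η ⊗ ⋯ ⊗ η`. -/
structure TensorHom {h : ℕ} (A : DGAModule K) (B : Fin h → DGAModule K) (C : DGAModule K) where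
  /-- the multilinear map on elements of degrees `p, q_1, …, q_h`,
  with values in degree `t = p + q_1 + ⋯ + q_h` -/
  toFun : ∀ (p : ℤ) (q : Fin h → ℤ) (t : ℤ), p + ∑ k, q k = t →
    (A.cx.X p →ₗ[K] MultilinearMap K (fun k => (B k).cx.X (q k)) (C.cx.X t))
  /-- compatibility with the differentials -/
  map_d : ∀ (p : ℤ) (q : Fin h → ℤ) (t : ℤ) (ht : p + ∑ k, q k = t)
    (x : A.cx.X p) (y : ∀ k, (B k).cx.X (q k)),
    (C.cx.d t (t - 1)).hom (toFun p q t ht x y) =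
      toFun (p - 1) q (t - 1) (by rw [← ht]; ring) ((A.cx.d p (p - 1)).hom x) y +
      ∑ j, Int.negOnePow (p + ∑ k ∈ Finset.univ.filter (· < j), q k) •
        toFun p (Function.update q j (q j - 1)) (t - 1) (sum_update_degree q j ht) x
          (dAt (fun k => (B k).cx) y j)
  /-- compatibility with the augmentations -/
  map_aug : ∀ (p : ℤ) (q : Fin h → ℤ) (t : ℤ) (ht : p + ∑ k, q k = t)
    (x : A.cx.X p) (y : ∀ k, (B k).cx.X (q k)),
    C.aug t (toFun p q t ht x y) = A.aug p x * ∏ k, (B k).aug (q k) (y k)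
  /-- compatibility with the coaugmentations -/
  map_coaug : toFun 0 (fun _ => 0) 0 (by simp) (A.coaug 1) (fun k => (B k).coaug 1) = C.coaug 1

end TensorHom

/-! ### Permutations and signs -/

section Combinatorics

/-- The bijection between `{(j, a) | j ∈ [h], a ∈ [i_j]}`, ordered lexicographically, and `[n]`,
where `n = i_1 + ⋯ + i_h`. -/
def blockEquiv {h n : ℕ} (i : Fin h → ℕ) (hn : ∑ j, i j = n) : (Σ j, Fin (i j)) ≃ Fin n :=
  finSigmaFinEquiv.trans (finCongr hn)

lemma sum_blockEquiv {M : Type*} [AddCommMonoid M] {h n : ℕ} (i : Fin h → ℕ)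
    (hn : ∑ j, i j = n) (r : ∀ j, Fin (i j) → M) :
    ∑ k, r ((blockEquiv i hn).symm k).1 ((blockEquiv i hn).symm k).2 = ∑ j, ∑ a, r j a := by
  rw [(blockEquiv i hn).symm.sum_comp (fun s : Σ j, Fin (i j) => r s.1 s.2),
    ← Finset.univ_sigma_univ, Finset.sum_sigma]

lemma sum_perm {M : Type*} [AddCommMonoid M] {h : ℕ} (σ : Equiv.Perm (Fin h)) (f : Fin h → M) :
    ∑ j, f (σ j) = ∑ j, f j :=
  Equiv.sum_comp σ f

/-- The block permutation `σ(i_1, …, i_h)` of `[n]`: the `j`-th block of the partition of `[n]`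
into blocks of lengths `i_{σ(1)}, …, i_{σ(h)}` is sent, preserving the order, onto the
`σ(j)`-th block of the partition into blocks of lengths `i_1, …, i_h`. -/
def blockPerm {h n : ℕ} (σ : Equiv.Perm (Fin h)) (i : Fin h → ℕ) (hn : ∑ j, i j = n) :
    Equiv.Perm (Fin n) :=
  (blockEquiv (fun j => i (σ j)) ((sum_perm σ i).trans hn)).symm.trans
    ((Equiv.sigmaCongrLeft (β := fun j => Fin (i j)) σ).trans (blockEquiv i hn))

/-- The direct sum `τ_1 ⊕ ⋯ ⊕ τ_h` of permutations. -/
def directSumPerm {h n : ℕ} (i : Fin h → ℕ) (hn : ∑ j, i j = n)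
    (τ : ∀ j, Equiv.Perm (Fin (i j))) : Equiv.Perm (Fin n) :=
  (blockEquiv i hn).symm.trans ((Equiv.sigmaCongrRight τ).trans (blockEquiv i hn))

/-- The Koszul sign of `y_1 ⊗ ⋯ ⊗ y_h ↦ ± y_{σ(1)} ⊗ ⋯ ⊗ y_{σ(h)}`, where `y_j` has degree
`q_j`. -/
def permSign {h : ℕ} (σ : Equiv.Perm (Fin h)) (q : Fin h → ℤ) : ℤˣ :=
  Int.negOnePow (∑ j, ∑ k, if j < k ∧ σ k < σ j then q (σ j) * q (σ k) else 0)

/-- The Koszul sign of the interchange of factors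
`y_1 ⊗ ⋯ ⊗ y_h ⊗ z_1 ⊗ ⋯ ⊗ z_h ↦ ± (y_1 ⊗ z_1) ⊗ ⋯ ⊗ (y_h ⊗ z_h)`, where `y_a` has degree
`q_a` and `z_a` has degree `s_a`. -/
def interchangeSign {h : ℕ} (q s : Fin h → ℤ) : ℤˣ :=
  Int.negOnePow (∑ a, ∑ b, if b < a then q a * s b else 0)

end Combinatorics

/-! ### Symmetric sequences of DGA-modules -/

/-- An `𝕊`-module: a family `M(n)`, `n ≥ 0`, of DGA-modules with right DGA-actions
`M(n) ⊗ K[Σ_n] → M(n)`.  The group algebra `K[Σ_n]` is concentrated in degree `0`, its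
augmentation sends every permutation to `1`, and its coaugmentation is the unit `1 ↦ e` of the
algebra.  So each permutation acts by an automorphism of the DG-module `M(n)` that preserves the
augmentation; the compatibility with the coaugmentations says that `e` fixes `η(1)`, which
follows from `act_one`. -/
structure SModule (K : Type u) [Field K] where
  /-- the components -/
  obj : ℕ → DGAModule K
  /-- the right action `x ↦ x σ` of `Σ_n` on the `n`-th component -/
  act : ∀ n : ℕ, Equiv.Perm (Fin n) → ((obj n).cx ⟶ (obj n).cx)
  act_one : ∀ n, act n 1 = 𝟙 _
  act_mul : ∀ n (σ τ : Equiv.Perm (Fin n)), act n (σ * τ) = act n σ ≫ act n τ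
  aug_act : ∀ n (σ : Equiv.Perm (Fin n)) (p : ℤ) (x : (obj n).cx.X p),
    (obj n).aug p (((act n σ).f p).hom x) = (obj n).aug p x

namespace SModule

variable {K : Type u} [Field K]

/-- Elements of degree `p` of `M(n)`. -/
abbrev El (M : SModule K) (n : ℕ) (p : ℤ) : ModuleCat.{u} K := (M.obj n).cx.X p

/-- `x σ`, for `x ∈ M(n)` of degree `p` and `σ ∈ Σ_n`. -/
def ract (M : SModule K) {n : ℕ} {p : ℤ} (x : M.El n p) (σ : Equiv.Perm (Fin n)) : M.El n p :=
  ((M.act n σ).f p).hom x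

/-- Morphisms of `𝕊`-modules: families of equivariant morphisms of DGA-modules. -/
@[ext]
structure Hom (M N : SModule K) where
  /-- the components -/
  app : ∀ n, M.obj n ⟶ N.obj n
  equivariant : ∀ n (σ : Equiv.Perm (Fin n)),
    M.act n σ ≫ DGAModule.Hom.f (app n) = DGAModule.Hom.f (app n) ≫ N.act n σ

instance : Category (SModule K) where
  Hom M N := Hom M N
  id M := { app := fun n => 𝟙 _, equivariant := by simp }
  comp f g :=
    { app := fun n => f.app n ≫ g.app n
      equivariant := by
        intro n σ
        rw [DGAModule.comp_f, ← Category.assoc, f.equivariant, Category.assoc, g.equivariant,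
          Category.assoc] }

@[simp] lemma id_app (M : SModule K) (n : ℕ) : Hom.app (𝟙 M) n = 𝟙 (M.obj n) := rfl

@[simp] lemma comp_app {M N L : SModule K} (f : M ⟶ N) (g : N ⟶ L) (n : ℕ) :
    Hom.app (f ≫ g) n = Hom.app f n ≫ Hom.app g n := rfl

@[ext] lemma hom_ext {M N : SModule K} (f g : M ⟶ N) (h : ∀ n, Hom.app f n = Hom.app g n) :
    f = g :=
  Hom.ext (funext h)

end SModule

/-! ### Symmetric operads -/

/-- A symmetric operad in DGA-modules, in the sense of May. -/
structure DGAOperad (K : Type u) [Field K] extends SModule K where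
  /-- the unit `η : K → P(1)`, a morphism of DGA-modules -/
  unit : DGAModule.ground K ⟶ obj 1
  /-- the composition `γ : P(h) ⊗ P(i_1) ⊗ ⋯ ⊗ P(i_h) → P(n)`, where `n = i_1 + ⋯ + i_h` -/
  comp : ∀ {h n : ℕ} (i : Fin h → ℕ), ∑ j, i j = n →
    TensorHom (obj h) (fun j => obj (i j)) (obj n)
  /-- associativity, `γ(γ(x; y); z) = ± γ(x; γ(y_1; z_1), …, γ(y_h; z_h))` -/
  assoc : ∀ {h n m : ℕ} (i : Fin h → ℕ) (hn : ∑ a, i a = n) (r : ∀ a, Fin (i a) → ℕ)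
    (hm : ∑ a, ∑ b, r a b = m) {p t : ℤ} (q : Fin h → ℤ) (s : ∀ a, Fin (i a) → ℤ)
    (ht : (p + ∑ a, q a) + ∑ a, ∑ b, s a b = t)
    (x : toSModule.El h p) (y : ∀ a, toSModule.El (i a) (q a))
    (z : ∀ a b, toSModule.El (r a b) (s a b)),
    (comp (fun k => r ((blockEquiv i hn).symm k).1 ((blockEquiv i hn).symm k).2)
        ((sum_blockEquiv i hn r).trans hm)).toFun (p + ∑ a, q a)
        (fun k => s ((blockEquiv i hn).symm k).1 ((blockEquiv i hn).symm k).2) t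
        (by rw [sum_blockEquiv i hn s, ht])
        ((comp i hn).toFun p q _ rfl x y)
        (fun k => z ((blockEquiv i hn).symm k).1 ((blockEquiv i hn).symm k).2) =
      interchangeSign q (fun a => ∑ b, s a b) •
        (comp (fun a => ∑ b, r a b) hm).toFun p (fun a => q a + ∑ b, s a b) t
          (by rw [Finset.sum_add_distrib, ← add_assoc, ht]) x
          (fun a => (comp (r a) rfl).toFun (q a) (s a) _ rfl (y a) (z a))
  /-- right unit, `γ(x; 1, …, 1) = x` -/
  comp_unit : ∀ {n : ℕ} {p : ℤ} (x : toSModule.El n p),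
    (comp (fun _ : Fin n => 1) (by simp)).toFun p (fun _ => 0) p (by simp) x
      (fun _ => DGAModule.ev unit 0 ((DGAModule.ground K).coaug 1)) = x
  /-- left unit, `γ(1; y) = y` -/
  unit_comp : ∀ {n : ℕ} {p : ℤ} (y : toSModule.El n p),
    (comp (fun _ : Fin 1 => n) (by simp)).toFun 0 (fun _ => p) p (by simp)
      (DGAModule.ev unit 0 ((DGAModule.ground K).coaug 1)) (fun _ => y) = y
  /-- first equivariance condition,
  `± γ(x σ; y_{σ(1)}, …, y_{σ(h)}) = γ(x; y_1, …, y_h) σ(i_1, …, i_h)` -/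
  equivariant_left : ∀ {h n : ℕ} (i : Fin h → ℕ) (hn : ∑ j, i j = n)
    (σ : Equiv.Perm (Fin h)) {p t : ℤ} (q : Fin h → ℤ) (ht : p + ∑ j, q j = t)
    (x : toSModule.El h p) (y : ∀ j, toSModule.El (i j) (q j)),
    permSign σ q •
      (comp (fun j => i (σ j)) ((sum_perm σ i).trans hn)).toFun p (fun j => q (σ j)) t
        (by rw [sum_perm σ q, ht]) (toSModule.ract x σ) (fun j => y (σ j)) =
      toSModule.ract ((comp i hn).toFun p q t ht x y) (blockPerm σ i hn)
  /-- second equivariance condition,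
  `γ(x; y_1 τ_1, …, y_h τ_h) = γ(x; y_1, …, y_h) (τ_1 ⊕ ⋯ ⊕ τ_h)` -/
  equivariant_right : ∀ {h n : ℕ} (i : Fin h → ℕ) (hn : ∑ j, i j = n)
    (τ : ∀ j, Equiv.Perm (Fin (i j))) {p t : ℤ} (q : Fin h → ℤ) (ht : p + ∑ j, q j = t)
    (x : toSModule.El h p) (y : ∀ j, toSModule.El (i j) (q j)),
    (comp i hn).toFun p q t ht x (fun j => toSModule.ract (y j) (τ j)) =
      toSModule.ract ((comp i hn).toFun p q t ht x y) (directSumPerm i hn τ)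

namespace DGAOperad

variable {K : Type u} [Field K]

/-- Morphisms of operads: morphisms of `𝕊`-modules that preserve units and compositions. -/
@[ext]
structure Hom (P Q : DGAOperad K) where
  /-- the underlying morphism of `𝕊`-modules -/
  toSHom : P.toSModule ⟶ Q.toSModule
  map_unit : P.unit ≫ SModule.Hom.app toSHom 1 = Q.unit
  map_comp : ∀ {h n : ℕ} (i : Fin h → ℕ) (hn : ∑ j, i j = n) {p t : ℤ} (q : Fin h → ℤ)
    (ht : p + ∑ j, q j = t) (x : P.El h p) (y : ∀ j, P.El (i j) (q j)),
    DGAModule.ev (SModule.Hom.app toSHom n) t ((P.comp i hn).toFun p q t ht x y) =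
      (Q.comp i hn).toFun p q t ht (DGAModule.ev (SModule.Hom.app toSHom h) p x)
        (fun j => DGAModule.ev (SModule.Hom.app toSHom (i j)) (q j) (y j))

/-- The category of symmetric operads in DGA-modules. -/
instance : Category (DGAOperad K) where
  Hom P Q := Hom P Q
  id P :=
    { toSHom := 𝟙 _
      map_unit := by simp
      map_comp := by intros; simp [DGAModule.ev] }
  comp f g :=
    { toSHom := f.toSHom ≫ g.toSHom
      map_unit := by
        rw [SModule.comp_app, ← Category.assoc, f.map_unit, g.map_unit]
      map_comp := by
        intro h n i hn p t q ht x y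
        exact (congrArg (DGAModule.ev (SModule.Hom.app g.toSHom n) t)
          (f.map_comp i hn q ht x y)).trans (g.map_comp i hn q ht _ _) }

/-- The forgetful functor from operads to `𝕊`-modules. -/
def forget (K : Type u) [Field K] : DGAOperad K ⥤ SModule K where
  obj P := P.toSModule
  map f := Hom.toSHom f
  map_id _ := rfl
  map_comp _ _ := rfl

end DGAOperad

/-! ### The reflexive pair attached to a diagram and an adjunction

Let `F : C ⥤ D` be left adjoint to `U : D ⥤ C`, let `P : J ⥤ D` be a diagram, let `A` be a
colimit cocone of `j ↦ U P_j` and `B` a colimit cocone of `j ↦ U F U P_j`. -/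

namespace ReflexivePairOfAdj

variable {J : Type u} [SmallCategory J] {C : Type u₁} [Category.{v₁} C] {D : Type u₂}
  [Category.{v₂} D] {F : C ⥤ D} {U : D ⥤ C} (adj : F ⊣ U) {P : J ⥤ D}
  {A : Cocone (P ⋙ U)} {B : Cocone (((P ⋙ U) ⋙ F) ⋙ U)}

/-- The morphism `F (colim U F U P) ⟶ F (colim U P)` adjoint to the morphism
`colim U F U P ⟶ U F (colim U P)` with components `U F (α_j)`, where `α` is the cocone `A`. -/
def d₀ (hB : IsColimit B) : F.obj B.pt ⟶ F.obj A.pt :=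
  (adj.homEquiv B.pt (F.obj A.pt)).symm (hB.desc (U.mapCocone (F.mapCocone A)))

/-- The cocone on `j ↦ U F U P_j` with components
`U F U P_j ⟶ U P_j ⟶ colim U P ⟶ U F (colim U P)`, given by the counit, the cocone `A` and the
unit. -/
def counitCocone (A : Cocone (P ⋙ U)) : Cocone (((P ⋙ U) ⋙ F) ⋙ U) where
  pt := U.obj (F.obj A.pt)
  ι :=
    { app := fun j =>
        U.map (adj.counit.app (P.obj j)) ≫ A.ι.app j ≫ adj.unit.app A.pt
      naturality := by
        intro j k f
        have h1 := A.w f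
        have h2 := congrArg U.map (adj.counit.naturality (P.map f))
        simp only [Functor.comp_obj, Functor.comp_map, Functor.id_obj, Functor.id_map,
          U.map_comp, Functor.const_obj_obj, Functor.const_obj_map, Category.comp_id] at h1 h2 ⊢
        rw [← Category.assoc, h2, Category.assoc, ← h1]
        simp only [Category.assoc] }

/-- The morphism `F (colim U F U P) ⟶ F (colim U P)` adjoint to the morphism
`colim U F U P ⟶ U F (colim U P)` induced by `counitCocone`. -/
def d₁ (hB : IsColimit B) : F.obj B.pt ⟶ F.obj A.pt :=
  (adj.homEquiv B.pt (F.obj A.pt)).symm (hB.desc (counitCocone adj A))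

/-- The cocone on `j ↦ U P_j` with components `U P_j ⟶ U F U P_j ⟶ colim U F U P`, given by the
unit and the cocone `B`. -/
def unitCocone (B : Cocone (((P ⋙ U) ⋙ F) ⋙ U)) : Cocone (P ⋙ U) where
  pt := B.pt
  ι :=
    { app := fun j => adj.unit.app (U.obj (P.obj j)) ≫ B.ι.app j
      naturality := by
        intro j k f
        have h1 := B.w f
        have h2 := adj.unit.naturality (U.map (P.map f))
        simp only [Functor.comp_obj, Functor.comp_map, Functor.id_obj, Functor.id_map,
          Functor.const_obj_obj, Functor.const_obj_map, Category.comp_id] at h1 h2 ⊢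
        rw [← Category.assoc, h2, Category.assoc, h1] }

/-- The common section `F (β)` of `d₀` and `d₁`, where `β : colim U P ⟶ colim U F U P` is induced
by the units `U P_j ⟶ U F U P_j`. -/
def s (hA : IsColimit A) : F.obj A.pt ⟶ F.obj B.pt :=
  F.map (hA.desc (unitCocone adj B))

end ReflexivePairOfAdj

-- All three existence statements (colimits of operads, colimits of `𝕊`-modules, free operads) come
-- from one construction, an explicit form of the adjoint functor theorem. The object sought is
-- initial among some candidates: the cocones on a diagram, or the operads `P` with a morphism `M ⟶
-- U P`. Form the product of all candidates and, inside it, the subobject generated by the images of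
-- the diagram or of `M`. The product is indexed by a type in a larger universe, but every element
-- of the subobject is the value of a formal expression in the generators, and these expressions
-- form a type in the universe of `K`; so the subobject is small. Its projections are the required
-- morphisms, and they are unique because morphisms that agree on generators agree
-- (`generated_hom_ext`).
--
-- A family in the product must have components with a common augmentation. Generated families have
-- this property because all morphisms involved preserve augmentations. Some candidate must exist,
-- from which the augmentation is read: the `𝕊`-module, or commutative operad, with all components
-- `K`, to which everything maps by its augmentation.
--
-- The coequalizer statement is formal up to one fact about operads. A morphism `π : F (colim U P) ⟶
-- Q` satisfies `d₀ ≫ π = d₁ ≫ π` exactly when each adjoint component `U P_j ⟶ U Q` becomes, after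
-- precomposition with the counit, the morphism underlying `F (α_j) ≫ π` (`d₀_comp_eq_d₁_comp_iff`).
-- The counit is surjective, being split by the unit after applying `U`, so such a component is
-- itself a morphism of operads (`exists_hom_of_surjective`). Hence morphisms out of the coequalizer
-- are the same as cocones on `P`.

universe w

/-! ### Augmentations as morphisms to the ground field, and the commutative operad. -/

namespace DGAModule

variable {K : Type u} [Field K]

/-- Reduces every identity in the ground field to an identity of scalars, where `TensorHom.map_aug`
computes both sides. In degree `0` the augmentation is an isomorphism inverse to the coaugmentation;
in other degrees the complex vanishes. -/
lemma ground_aug_injective (p : ℤ) : Function.Injective ((ground K).aug p) := by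
  by_cases hp : p = 0
  · subst hp
    have h : Function.LeftInverse (ground K).coaug ((ground K).aug 0) := by
      intro x
      simp only [ground, dif_pos]
      change (((HomologicalComplex.XIsoOfEq _ rfl ≪≫ HomologicalComplex.singleObjXSelf
        (ComplexShape.down ℤ) 0 (ModuleCat.of K K)).hom) ≫
        (HomologicalComplex.singleObjXSelf (ComplexShape.down ℤ) 0 (ModuleCat.of K K)).inv).hom x
          = x
      simp only [Iso.trans_hom, Category.assoc, Iso.hom_inv_id, Category.comp_id]
      rfl
    exact h.injective
  · intro x y _
    have := ModuleCat.subsingleton_of_isZero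
      (HomologicalComplex.isZero_single_obj_X (ComplexShape.down ℤ) 0 (ModuleCat.of K K) p hp)
    exact Subsingleton.elim (α := ((HomologicalComplex.single (ModuleCat.{u} K)
      (ComplexShape.down ℤ) 0).obj (ModuleCat.of K K)).X p) x y

/-- The coaugmentation of the ground field, extended by zero to all degrees. -/
noncomputable def groundIncl (K : Type u) [Field K] (p : ℤ) : K →ₗ[K] (ground K).cx.X p :=
  if h : p = 0 then h ▸ (ground K).coaug else 0

lemma groundIncl_zero : groundIncl K 0 = (ground K).coaug := by
  simp [groundIncl]

/-- The hypothesis is needed because `groundIncl` is zero outside degree `0`; it holds for every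
scalar that is an augmentation of an element of degree `p`. -/
lemma aug_groundIncl (p : ℤ) (a : K) (ha : p ≠ 0 → a = 0) :
    (ground K).aug p (groundIncl K p a) = a := by
  by_cases hp : p = 0
  · subst hp
    rw [groundIncl_zero, aug_coaug]
  · simp [ha hp]

lemma aug_apply_eq_zero (M : DGAModule K) {p : ℤ} (hp : p ≠ 0) (x : M.cx.X p) : M.aug p x = 0 := by
  rw [M.aug_eq_zero p hp, LinearMap.zero_apply]

lemma aug_ev {M N : DGAModule K} (f : M ⟶ N) (p : ℤ) (x : M.cx.X p) :
    N.aug p (ev f p x) = M.aug p x :=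
  f.aug_comp p x

lemma aug_units_smul (M : DGAModule K) (e : ℤˣ) {p : ℤ}
    (x : M.cx.X p) : M.aug p (e • x) = e • M.aug p x := by
  rw [Units.smul_def, Units.smul_def, map_zsmul]

lemma ev_d {M N : DGAModule K} (f : M ⟶ N) (p p' : ℤ) (x : M.cx.X p) :
    ev f p' ((M.cx.d p p').hom x) = (N.cx.d p p').hom (ev f p x) :=
  (congrArg (fun g => ModuleCat.Hom.hom g x) ((DGAModule.Hom.f f).comm p p')).symm

lemma ev_units_smul {M N : DGAModule K} (f : M ⟶ N) (e : ℤˣ) {p : ℤ}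
    (x : M.cx.X p) : ev f p (e • x) = e • ev f p x := by
  rw [Units.smul_def, Units.smul_def, map_zsmul]

lemma ev_coaug {M N : DGAModule K} (f : M ⟶ N) (a : K) : ev f 0 (M.coaug a) = N.coaug a :=
  f.comp_coaug a

/-- The augmentation, as a morphism of DGA-modules. -/
noncomputable def augHom (M : DGAModule K) : M ⟶ ground K where
  f :=
    { f := fun p => ModuleCat.ofHom (groundIncl K p ∘ₗ M.aug p)
      comm' := by
        intro p p' _
        refine ModuleCat.hom_ext (LinearMap.ext fun x => ground_aug_injective _ ?_)
        have h : groundIncl K p' (M.aug p' ((M.cx.d p p').hom x)) = 0 := by rw [M.aug_d, map_zero]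
        exact ((ground K).aug_d p p' _).trans
          ((congrArg ((ground K).aug p') h).trans (map_zero _)).symm }
  aug_comp p x := aug_groundIncl p _ (fun hp => M.aug_apply_eq_zero hp x)
  comp_coaug a := by
    change groundIncl K 0 (M.aug 0 (M.coaug a)) = _
    rw [groundIncl_zero, M.aug_coaug]

end DGAModule

section TensorHom

variable {K : Type u} [Field K]

/-- If the total degree is nonzero then some factor has nonzero degree, and its augmentation
vanishes. -/
lemma aug_mul_prod_aug_eq_zero {h : ℕ} (A : DGAModule K) (B : Fin h → DGAModule K) {p t : ℤ}
    {q : Fin h → ℤ} (ht : p + ∑ k, q k = t) (x : A.cx.X p) (y : ∀ k, (B k).cx.X (q k))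
    (h0 : t ≠ 0) : A.aug p x * ∏ k, (B k).aug (q k) (y k) = 0 := by
  by_cases hp : p = 0
  · obtain ⟨k, hk⟩ : ∃ k, q k ≠ 0 := by
      by_contra! hq
      exact h0 (by simp [← ht, hp, hq])
    rw [Finset.prod_eq_zero (Finset.mem_univ k) ((B k).aug_apply_eq_zero hk _), mul_zero]
  · rw [A.aug_apply_eq_zero hp, zero_mul]

/-- The product of the augmentations, as a morphism to the ground field. -/
noncomputable def augTensorHom {h : ℕ} (A : DGAModule K) (B : Fin h → DGAModule K) :
    TensorHom A B (DGAModule.ground K) where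
  toFun p q t _ := (A.aug p).smulRight ((DGAModule.groundIncl K t).compMultilinearMap
    ((MultilinearMap.mkPiAlgebra K (Fin h) K).compLinearMap (fun k => (B k).aug (q k))))
  map_d p q t ht x y := by
    -- Each term on the right of the Leibniz formula contains the augmentation of a boundary, so all
    -- of them vanish and the Koszul signs play no role.
    have H : ∀ (p : ℤ) (q : Fin h → ℤ) (t : ℤ) (_ : p + ∑ k, q k = t)
        (x : A.cx.X p) (y : ∀ k, (B k).cx.X (q k)),
        A.aug p x * ∏ k, (B k).aug (q k) (y k) = 0 →
        ((A.aug p).smulRight ((DGAModule.groundIncl K t).compMultilinearMap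
          ((MultilinearMap.mkPiAlgebra K (Fin h) K).compLinearMap
            (fun k => (B k).aug (q k))))) x y = 0 := by
      intro p q t _ x y h0
      simp only [LinearMap.smulRight_apply, _root_.smul_apply,
        LinearMap.compMultilinearMap_apply, MultilinearMap.compLinearMap_apply,
        MultilinearMap.mkPiAlgebra_apply]
      rw [← map_smul, smul_eq_mul, h0, map_zero]
    apply DGAModule.ground_aug_injective
    rw [DGAModule.aug_d, H _ _ _ _ _ _ (by rw [A.aug_d, zero_mul]), zero_add,
      Finset.sum_eq_zero, map_zero]
    · intro j _
      rw [H _ _ _ (sum_update_degree q j ht), smul_zero]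
      rw [Finset.prod_eq_zero (Finset.mem_univ j), mul_zero]
      simp only [dAt, dif_pos]
      exact (B j).aug_d _ _ _
    · rw [← ht]; ring
  map_aug p q t ht x y := by
    simp only [LinearMap.smulRight_apply, _root_.smul_apply,
      LinearMap.compMultilinearMap_apply, MultilinearMap.compLinearMap_apply,
      MultilinearMap.mkPiAlgebra_apply]
    rw [← map_smul, smul_eq_mul, DGAModule.aug_groundIncl]
    exact aug_mul_prod_aug_eq_zero A B ht x y
  map_coaug := by
    simp [DGAModule.groundIncl_zero, DGAModule.aug_coaug]

end TensorHom

/-- Disposes of the Koszul signs in the commutative operad: a nonzero product of augmentations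
forces the degrees to be `0`, hence the exponent of the sign too. -/
lemma negOnePow_smul_eq_self {K : Type u} [Field K] {a : K} {e : ℤ} (h : a ≠ 0 → e = 0) :
    Int.negOnePow e • a = a := by
  by_cases ha : a = 0
  · simp [ha]
  · simp [h ha]

lemma prod_blockEquiv {M : Type*} [CommMonoid M] {h n : ℕ} (i : Fin h → ℕ)
    (hn : ∑ j, i j = n) (r : ∀ j, Fin (i j) → M) :
    ∏ k, r ((blockEquiv i hn).symm k).1 ((blockEquiv i hn).symm k).2 = ∏ j, ∏ a, r j a := by
  rw [(blockEquiv i hn).symm.prod_comp (fun s : Σ j, Fin (i j) => r s.1 s.2),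
    ← Finset.univ_sigma_univ, Finset.prod_sigma]

/-- The `𝕊`-module all of whose components are the ground field, with the trivial actions. -/
noncomputable def SModule.ground (K : Type u) [Field K] : SModule K where
  obj _ := DGAModule.ground K
  act _ _ := 𝟙 _
  act_one _ := rfl
  act_mul _ _ _ := (Category.id_comp _).symm
  aug_act _ _ _ _ := rfl

/-- The augmentations of an `𝕊`-module, as a morphism of `𝕊`-modules. -/
noncomputable def SModule.augHom {K : Type u} [Field K] (M : SModule K) :
    M ⟶ SModule.ground K where
  app n := (M.obj n).augHom
  equivariant n σ := by
    refine HomologicalComplex.hom_ext _ _ fun p => ModuleCat.hom_ext (LinearMap.ext fun x => ?_)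
    exact congrArg (DGAModule.groundIncl K p) (M.aug_act n σ p x)

namespace DGAOperad

variable {K : Type u} [Field K]

/-- The commutative operad, all of whose components are the ground field. -/
noncomputable def commutative (K : Type u) [Field K] : DGAOperad K where
  toSModule := SModule.ground K
  unit := 𝟙 _
  comp i _ := augTensorHom (DGAModule.ground K) (fun _ => DGAModule.ground K)
  assoc {h n m} i hn r hm p t q s ht x y z := by
    apply DGAModule.ground_aug_injective
    refine (TensorHom.map_aug _ _ _ _ _ _ _).trans ?_
    refine Eq.trans ?_ (DGAModule.aug_units_smul (DGAModule.ground K) _ _).symm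
    refine Eq.trans ?_ (congrArg _ (TensorHom.map_aug _ _ _ _ _ _ _).symm)
    refine Eq.trans (congrArg (· * _) (TensorHom.map_aug _ _ _ _ _ _ _)) ?_
    have e : ∀ a, (DGAModule.ground K).aug _ (((augTensorHom (DGAModule.ground K)
        (fun _ => DGAModule.ground K)).toFun (q a) (s a) _ rfl) (y a) (z a)) = _ :=
      fun a => TensorHom.map_aug _ _ _ _ _ _ _
    refine Eq.trans ?_ (congrArg (fun c => interchangeSign q _ • (_ * c))
      (Finset.prod_congr rfl fun a _ => (e a).symm))
    rw [interchangeSign, negOnePow_smul_eq_self, Finset.prod_mul_distrib, ← mul_assoc]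
    · congr 1
      exact prod_blockEquiv i hn (fun a b => (DGAModule.ground K).aug (s a b) (z a b))
    -- The exponent of `interchangeSign` is a sum of multiples of the `q a`, so it suffices that
    -- these vanish.
    · intro h0
      have hq : ∀ a, q a = 0 := by
        intro a
        by_contra ha
        refine h0 ?_
        rw [Finset.prod_eq_zero (Finset.mem_univ a), mul_zero]
        erw [DGAModule.aug_apply_eq_zero _ ha, zero_mul]
      simp [hq]
  comp_unit {n p} x := by
    apply DGAModule.ground_aug_injective
    refine (TensorHom.map_aug _ _ _ _ _ _ _).trans ?_
    rw [Finset.prod_eq_one, mul_one]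
    · rfl
    · intro _ _
      exact (DGAModule.ground K).aug_coaug 1
  unit_comp {n p} y := by
    apply DGAModule.ground_aug_injective
    refine (TensorHom.map_aug _ _ _ _ _ _ _).trans ?_
    rw [Fin.prod_univ_one]
    refine (congrArg (· * _) ((DGAModule.ground K).aug_coaug 1)).trans (one_mul _)
  equivariant_left {h n} i hn σ p t q ht x y := by
    apply DGAModule.ground_aug_injective
    refine (DGAModule.aug_units_smul (DGAModule.ground K) _ _).trans ?_
    refine Eq.trans ?_ (TensorHom.map_aug (augTensorHom _ _) p q t ht x y).symm
    refine (congrArg _ (TensorHom.map_aug _ _ _ _ _ _ _)).trans ?_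
    rw [permSign, negOnePow_smul_eq_self]
    · congr 1
      exact Equiv.prod_comp σ (fun j => (DGAModule.ground K).aug (q j) (y j))
    · intro h0
      have hq : ∀ a, q (σ a) = 0 := by
        intro a
        by_contra ha
        refine h0 ?_
        rw [Finset.prod_eq_zero (Finset.mem_univ a), mul_zero]
        exact DGAModule.aug_apply_eq_zero _ ha _
      simp [hq]
  equivariant_right i hn τ p t q ht x y := rfl

/-- The augmentations of an operad, as a morphism of operads. -/
noncomputable def augHom (P : DGAOperad K) : P ⟶ commutative K where
  toSHom := P.toSModule.augHom
  map_unit := by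
    refine DGAModule.hom_ext _ _ (HomologicalComplex.hom_ext _ _ fun p =>
      ModuleCat.hom_ext (LinearMap.ext fun x => DGAModule.ground_aug_injective p ?_))
    exact (DGAModule.aug_ev (P.unit ≫ (P.obj 1).augHom) p x)
  map_comp {h n} i hn p t q ht x y := by
    apply DGAModule.ground_aug_injective
    refine (DGAModule.aug_ev ((P.obj n).augHom) _ _).trans ?_
    refine ((P.comp i hn).map_aug _ _ _ ht x y).trans ?_
    refine Eq.trans ?_ (TensorHom.map_aug _ _ _ _ _ _ _).symm
    refine congrArg₂ _ (DGAModule.aug_ev ((P.obj h).augHom) _ _).symm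
      (Finset.prod_congr rfl fun j _ => (DGAModule.aug_ev ((P.obj (i j)).augHom) _ _).symm)

end DGAOperad

/-! ### Small `𝕊`-submodules of large products. -/

namespace SModule

variable {K : Type u} [Field K]

lemma aug_ract (M : SModule K) {n : ℕ} {p : ℤ} (x : M.El n p) (σ : Equiv.Perm (Fin n)) :
    (M.obj n).aug p (M.ract x σ) = (M.obj n).aug p x :=
  M.aug_act n σ p x

lemma ev_ract {M N : SModule K} (f : M ⟶ N) {n : ℕ} {p : ℤ} (x : M.El n p)
    (σ : Equiv.Perm (Fin n)) :
    DGAModule.ev (Hom.app f n) p (M.ract x σ) = N.ract (DGAModule.ev (Hom.app f n) p x) σ :=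
  congrArg (fun g : (M.obj n).cx ⟶ (N.obj n).cx => (g.f p).hom x) (Hom.equivariant f n σ)

lemma hom_ext_ev {M N : SModule K} {f g : M ⟶ N}
    (h : ∀ n p x, DGAModule.ev (Hom.app f n) p x = DGAModule.ev (Hom.app g n) p x) : f = g :=
  hom_ext _ _ fun n => DGAModule.hom_ext _ _ <| HomologicalComplex.hom_ext _ _ fun p =>
    ModuleCat.hom_ext (LinearMap.ext (h n p))

/-- A small `𝕊`-submodule of the (possibly large) product of a family of `𝕊`-modules, on which
the augmentations of the factors agree. -/
structure SmallSub {I : Type w} (S : I → SModule K) where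
  /-- the elements, degree by degree -/
  carrier : ∀ (n : ℕ) (p : ℤ), Submodule K (∀ i, (S i).El n p)
  small : ∀ n p, Small.{u} (carrier n p)
  d_mem : ∀ (n : ℕ) (p p' : ℤ) (x : ∀ i, (S i).El n p), x ∈ carrier n p →
    (fun i => (((S i).obj n).cx.d p p').hom (x i)) ∈ carrier n p'
  act_mem : ∀ (n : ℕ) (σ : Equiv.Perm (Fin n)) (p : ℤ) (x : ∀ i, (S i).El n p),
    x ∈ carrier n p → (fun i => (S i).ract (x i) σ) ∈ carrier n p
  coaug_mem : ∀ n, (fun i => ((S i).obj n).coaug 1) ∈ carrier n 0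
  aug_eq : ∀ (n : ℕ) (p : ℤ) (x : ∀ i, (S i).El n p), x ∈ carrier n p →
    ∀ i j, ((S i).obj n).aug p (x i) = ((S j).obj n).aug p (x j)

namespace SmallSub

variable {I : Type w} {S : I → SModule K} (W : SmallSub S)

instance (n : ℕ) (p : ℤ) : Small.{u} (W.carrier n p) := W.small n p

/-- The elements of a small `𝕊`-submodule, in the universe of the base field. -/
abbrev Carrier (n : ℕ) (p : ℤ) : Type u := Shrink.{u} (W.carrier n p)

/-- The components of an element of a small `𝕊`-submodule of a product. -/
noncomputable def val (n : ℕ) (p : ℤ) (i : I) : W.Carrier n p →ₗ[K] (S i).El n p :=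
  LinearMap.proj i ∘ₗ (W.carrier n p).subtype ∘ₗ
    (Shrink.linearEquiv.{u} K (W.carrier n p)).toLinearMap

variable {W}

lemma val_mem {n : ℕ} {p : ℤ} (x : W.Carrier n p) : (fun i => W.val n p i x) ∈ W.carrier n p :=
  (Shrink.linearEquiv.{u} K (W.carrier n p) x).2

lemma ext_val {n : ℕ} {p : ℤ} {x y : W.Carrier n p} (h : ∀ i, W.val n p i x = W.val n p i y) :
    x = y :=
  (Shrink.linearEquiv.{u} K (W.carrier n p)).injective (Subtype.ext (funext h))

variable (W)

/-- The element with given components. -/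
noncomputable def ofMem {n : ℕ} {p : ℤ} (x : ∀ i, (S i).El n p) (hx : x ∈ W.carrier n p) :
    W.Carrier n p :=
  (Shrink.linearEquiv.{u} K (W.carrier n p)).symm ⟨x, hx⟩

@[simp] lemma val_ofMem {n : ℕ} {p : ℤ} (x : ∀ i, (S i).El n p) (hx : x ∈ W.carrier n p) (i : I) :
    W.val n p i (W.ofMem x hx) = x i := by
  simp [val, ofMem]

/-- The linear map with given components. -/
noncomputable def liftMap {n : ℕ} {p : ℤ} {V : Type*} [AddCommGroup V] [Module K V]
    (f : ∀ i, V →ₗ[K] (S i).El n p) (hf : ∀ x, (fun i => f i x) ∈ W.carrier n p) :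
    V →ₗ[K] W.Carrier n p where
  toFun x := W.ofMem _ (hf x)
  map_add' x y := ext_val fun i => by simp
  map_smul' a x := ext_val fun i => by simp

@[simp] lemma val_liftMap {n : ℕ} {p : ℤ} {V : Type*} [AddCommGroup V] [Module K V]
    (f : ∀ i, V →ₗ[K] (S i).El n p) (hf : ∀ x, (fun i => f i x) ∈ W.carrier n p) (x : V) (i : I) :
    W.val n p i (W.liftMap f hf x) = f i x :=
  W.val_ofMem _ _ i

/-- The differential of a small `𝕊`-submodule of a product. -/
noncomputable def dMap (n : ℕ) (p p' : ℤ) : W.Carrier n p →ₗ[K] W.Carrier n p' :=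
  W.liftMap (fun i => (((S i).obj n).cx.d p p').hom ∘ₗ W.val n p i)
    (fun x => W.d_mem n p p' _ (val_mem x))

lemma val_dMap {n : ℕ} (p p' : ℤ) (x : W.Carrier n p) (i : I) :
    W.val n p' i (W.dMap n p p' x) = (((S i).obj n).cx.d p p').hom (W.val n p i x) :=
  W.val_liftMap _ _ x i

/-- The actions of permutations on a small `𝕊`-submodule of a product. -/
noncomputable def actMap {n : ℕ} (σ : Equiv.Perm (Fin n)) (p : ℤ) :
    W.Carrier n p →ₗ[K] W.Carrier n p :=
  W.liftMap (fun i => (((S i).act n σ).f p).hom ∘ₗ W.val n p i)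
    (fun x => W.act_mem n σ p _ (val_mem x))

lemma val_actMap {n : ℕ} (σ : Equiv.Perm (Fin n)) (p : ℤ) (x : W.Carrier n p) (i : I) :
    W.val n p i (W.actMap σ p x) = (S i).ract (W.val n p i x) σ :=
  W.val_liftMap _ _ x i

/-- The coaugmentations of a small `𝕊`-submodule of a product. -/
noncomputable def coaugMap (n : ℕ) : K →ₗ[K] W.Carrier n 0 :=
  W.liftMap (fun i => ((S i).obj n).coaug) (fun a => by
    have h := (W.carrier n 0).smul_mem a (W.coaug_mem n)
    convert h using 1
    funext i
    rw [Pi.smul_apply, ← map_smul, smul_eq_mul, mul_one])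

lemma val_coaugMap (n : ℕ) (a : K) (i : I) :
    W.val n 0 i (W.coaugMap n a) = ((S i).obj n).coaug a :=
  W.val_liftMap _ _ a i

/-- The underlying complexes of a small `𝕊`-submodule of a product. -/
noncomputable def cx (n : ℕ) : ChainComplex (ModuleCat.{u} K) ℤ where
  X p := ModuleCat.of K (W.Carrier n p)
  d p p' := ModuleCat.ofHom (W.dMap n p p')
  shape p p' h := by
    refine ModuleCat.hom_ext (LinearMap.ext fun x => ext_val fun i => ?_)
    refine (W.val_dMap p p' x i).trans ?_
    rw [((S i).obj n).cx.shape p p' h]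
    exact (map_zero (W.val n p' i)).symm
  d_comp_d' p p' p'' _ _ := by
    refine ModuleCat.hom_ext (LinearMap.ext fun x => ext_val fun i => ?_)
    refine (W.val_dMap p' p'' (W.dMap n p p' x) i).trans ?_
    rw [W.val_dMap]
    refine Eq.trans ?_ (map_zero (W.val n p'' i)).symm
    exact congrArg (fun g => ModuleCat.Hom.hom g (W.val n p i x))
      (((S i).obj n).cx.d_comp_d p p' p'')

variable [hI : Nonempty I]

/-- The components of a small `𝕊`-submodule of a product. -/
noncomputable def dga (n : ℕ) : DGAModule K where
  cx := W.cx n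
  -- Any factor would give the same augmentation, by `aug_eq`; this is where the index type has to
  -- be nonempty.
  aug p := ((S hI.some).obj n).aug p ∘ₗ W.val n p hI.some
  coaug := W.coaugMap n
  aug_eq_zero p hp := LinearMap.ext fun x => DGAModule.aug_apply_eq_zero _ hp _
  aug_d p p' x := (congrArg _ (W.val_dMap p p' x hI.some)).trans
    (((S hI.some).obj n).aug_d p p' _)
  d_coaug p a := ext_val fun i => by
    refine (W.val_dMap 0 p (W.coaugMap n a) i).trans ?_
    rw [W.val_coaugMap]
    exact (((S i).obj n).d_coaug p a).trans (map_zero (W.val n p i)).symm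
  aug_coaug a := (congrArg _ (W.val_coaugMap n a hI.some)).trans (DGAModule.aug_coaug _ _)

/-- A small `𝕊`-submodule of a product, as an `𝕊`-module. -/
noncomputable def toSModule : SModule K where
  obj n := W.dga n
  act n σ :=
    { f := fun p => ModuleCat.ofHom (W.actMap σ p)
      comm' := fun p p' _ => by
        refine ModuleCat.hom_ext (LinearMap.ext fun (x : W.Carrier n p) => ext_val fun i => ?_)
        refine (W.val_dMap p p' (W.actMap σ p x) i).trans ?_
        refine Eq.trans ?_ (W.val_actMap σ p' (W.dMap n p p' x) i).symm
        rw [W.val_actMap, W.val_dMap]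
        exact congrArg (fun g => ModuleCat.Hom.hom g (W.val n p i x)) (((S i).act n σ).comm p p') }
  act_one n := by
    refine HomologicalComplex.hom_ext _ _ fun p => ModuleCat.hom_ext (LinearMap.ext fun (x : W.Carrier n p) =>
      ext_val fun i => (W.val_actMap 1 p x i).trans ?_)
    rw [ract, (S i).act_one]
    rfl
  act_mul n σ τ := by
    refine HomologicalComplex.hom_ext _ _ fun p => ModuleCat.hom_ext (LinearMap.ext fun (x : W.Carrier n p) =>
      ext_val fun i => (W.val_actMap (σ * τ) p x i).trans ?_)
    refine Eq.trans ?_ (W.val_actMap τ p (W.actMap σ p x) i).symm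
    rw [W.val_actMap, ract, (S i).act_mul]
    rfl
  aug_act n σ p x := (congrArg _ (W.val_actMap σ p x hI.some)).trans
    ((S hI.some).aug_ract _ _)

/-- The projections from a small `𝕊`-submodule of a product to the factors. -/
noncomputable def proj (i : I) : W.toSModule ⟶ S i where
  app n :=
    { f :=
        { f := fun p => ModuleCat.ofHom (W.val _ p i)
          comm' := fun p p' _ => ModuleCat.hom_ext (LinearMap.ext fun x =>
            (W.val_dMap p p' x i).symm) }
      aug_comp := fun p x => W.aug_eq n p _ (val_mem x) _ _
      comp_coaug := fun a => W.val_coaugMap n a i }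
  equivariant _ σ := HomologicalComplex.hom_ext _ _ fun p =>
    ModuleCat.hom_ext (LinearMap.ext fun x => W.val_actMap σ p x i)

/-- The element with given components. -/
noncomputable def elem {n : ℕ} {p : ℤ} (x : ∀ i, (S i).El n p) (hx : x ∈ W.carrier n p) :
    W.toSModule.El n p :=
  W.ofMem x hx

@[simp] lemma ev_proj_elem {n : ℕ} {p : ℤ} (x : ∀ i, (S i).El n p) (hx : x ∈ W.carrier n p)
    (i : I) : DGAModule.ev (Hom.app (W.proj i) n) p (W.elem x hx) = x i :=
  W.val_ofMem x hx i

variable {W}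

lemma ext_proj {n : ℕ} {p : ℤ} {x y : W.toSModule.El n p}
    (h : ∀ i, DGAModule.ev (Hom.app (W.proj i) n) p x = DGAModule.ev (Hom.app (W.proj i) n) p y) :
    x = y :=
  ext_val h

lemma proj_mem {n : ℕ} {p : ℤ} (x : W.toSModule.El n p) :
    (fun i => DGAModule.ev (Hom.app (W.proj i) n) p x) ∈ W.carrier n p :=
  val_mem x

variable (W)

/-- The morphism to a small `𝕊`-submodule of a product with given components. -/
noncomputable def lift {N : SModule K} (f : ∀ i, N ⟶ S i)
    (hf : ∀ n p x, (fun i => DGAModule.ev (Hom.app (f i) n) p x) ∈ W.carrier n p) :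
    N ⟶ W.toSModule where
  app n :=
    { f :=
        { f := fun p => ModuleCat.ofHom (W.liftMap (fun i => DGAModule.ev (Hom.app (f i) n) p)
            (hf n p))
          comm' := fun p p' _ => by
            refine ModuleCat.hom_ext (LinearMap.ext fun x => ext_val fun i => ?_)
            refine (W.val_dMap p p' (W.liftMap _ (hf n p) x) i).trans ?_
            refine Eq.trans ?_ (W.val_liftMap _ (hf n p') ((N.obj n).cx.d p p' x) i).symm
            rw [W.val_liftMap]
            exact (DGAModule.ev_d (Hom.app (f i) n) p p' x).symm }
      aug_comp := fun p x => (congrArg _ (W.val_liftMap _ (hf n p) x hI.some)).trans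
        (DGAModule.aug_ev (Hom.app (f hI.some) n) p x)
      comp_coaug := fun a => ext_val fun i =>
        (W.val_liftMap _ (hf n 0) ((N.obj n).coaug a) i).trans
          (((Hom.app (f i) n).comp_coaug a).trans (W.val_coaugMap n a i).symm) }
  equivariant n σ := by
    refine HomologicalComplex.hom_ext _ _ fun p => ModuleCat.hom_ext (LinearMap.ext fun x =>
      ext_val fun i => (W.val_liftMap _ (hf n p) (N.ract x σ) i).trans ?_)
    refine Eq.trans ?_ (W.val_actMap σ p (W.liftMap _ (hf n p) x) i).symm
    rw [W.val_liftMap]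
    exact ev_ract (f i) x σ

@[simp] lemma ev_proj_lift {N : SModule K} (f : ∀ i, N ⟶ S i)
    (hf : ∀ n p x, (fun i => DGAModule.ev (Hom.app (f i) n) p x) ∈ W.carrier n p)
    {n : ℕ} {p : ℤ} (x : N.El n p) (i : I) :
    DGAModule.ev (Hom.app (W.proj i) n) p (DGAModule.ev (Hom.app (W.lift f hf) n) p x) =
      DGAModule.ev (Hom.app (f i) n) p x :=
  W.val_liftMap _ (hf n p) x i

lemma lift_proj {N : SModule K} (f : ∀ i, N ⟶ S i)
    (hf : ∀ n p x, (fun i => DGAModule.ev (Hom.app (f i) n) p x) ∈ W.carrier n p) (i : I) :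
    W.lift f hf ≫ W.proj i = f i :=
  hom_ext_ev fun _ _ x => W.ev_proj_lift f hf x i

lemma hom_ext_proj {N : SModule K} {f g : N ⟶ W.toSModule}
    (h : ∀ i, f ≫ W.proj i = g ≫ W.proj i) : f = g :=
  hom_ext_ev fun n p x => ext_proj fun i =>
    congrArg (fun k => DGAModule.ev (Hom.app k n) p x) (h i)

end SmallSub

end SModule

/-! ### Generation by a small family, and colimits of `𝕊`-modules. -/

namespace SModule

variable {K : Type u} [Field K]

/-- Formal expressions in generators, in the language of `𝕊`-modules. -/
inductive Term (K : Type u) (G : ℕ → ℤ → Type u) (n : ℕ) : ℤ → Type u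
  | gen {p : ℤ} (g : G n p) : Term K G n p
  | zero (p : ℤ) : Term K G n p
  | add {p : ℤ} (s t : Term K G n p) : Term K G n p
  | smul {p : ℤ} (a : K) (t : Term K G n p) : Term K G n p
  | d (p p' : ℤ) (t : Term K G n p) : Term K G n p'
  | act {p : ℤ} (σ : Equiv.Perm (Fin n)) (t : Term K G n p) : Term K G n p
  | coaug : Term K G n 0

/-- The value of a formal expression in an `𝕊`-module. -/
def Term.eval (M : SModule K) {G : ℕ → ℤ → Type u} (v : ∀ n p, G n p → M.El n p) {n : ℕ} :
    ∀ {p : ℤ}, Term K G n p → M.El n p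
  | _, gen g => v _ _ g
  | _, zero _ => 0
  | _, add s t => s.eval M v + t.eval M v
  | _, smul a t => a • t.eval M v
  | _, d p p' t => ((M.obj n).cx.d p p').hom (t.eval M v)
  | _, act σ t => M.ract (t.eval M v) σ
  | _, coaug => (M.obj n).coaug 1

lemma Term.ev_eval {M N : SModule K} (f : M ⟶ N) {G : ℕ → ℤ → Type u}
    (v : ∀ n p, G n p → M.El n p) {n : ℕ} {p : ℤ} (t : Term K G n p) :
    DGAModule.ev (Hom.app f n) p (t.eval M v) =
      t.eval N (fun n p g => DGAModule.ev (Hom.app f n) p (v n p g)) := by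
  induction t with
  | gen g => rfl
  | zero p => exact map_zero _
  | add s t hs ht => rw [eval, map_add, hs, ht, eval]
  | smul a t ht => rw [eval, map_smul, ht, eval]
  | d p p' t ht => rw [eval, DGAModule.ev_d, ht, eval]
  | act σ t ht => rw [eval, ev_ract, ht, eval]
  | coaug => exact (Hom.app f n).comp_coaug 1

variable {I : Type w} (S : I → SModule K) {G : ℕ → ℤ → Type u}
  (v : ∀ i n p, G n p → (S i).El n p)
  (hv : ∀ n p g i j, ((S i).obj n).aug p (v i n p g) = ((S j).obj n).aug p (v j n p g))

include hv in
lemma Term.aug_eval {n : ℕ} {p : ℤ} (t : Term K G n p) (i j : I) :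
    ((S i).obj n).aug p (t.eval (S i) (v i)) = ((S j).obj n).aug p (t.eval (S j) (v j)) := by
  induction t with
  | gen g => exact hv _ _ g i j
  | zero p => rw [eval, eval, map_zero, map_zero]
  | add s t hs ht => rw [eval, eval, map_add, map_add, hs, ht]
  | smul a t ht => rw [eval, eval, map_smul, map_smul, ht]
  | d p p' t ht => rw [eval, eval, DGAModule.aug_d, DGAModule.aug_d]
  | act σ t ht => rw [eval, eval, aug_ract, aug_ract, ht]
  | coaug => rw [eval, eval, DGAModule.aug_coaug, DGAModule.aug_coaug]

namespace SmallSub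

/-- The small `𝕊`-submodule of a product generated by a small family of elements. -/
def generated : SmallSub S where
  carrier n p :=
    { carrier := Set.range fun (t : Term K G n p) (i : I) => t.eval (S i) (v i)
      add_mem' := by
        rintro _ _ ⟨s, rfl⟩ ⟨t, rfl⟩
        exact ⟨s.add t, rfl⟩
      zero_mem' := ⟨Term.zero p, rfl⟩
      smul_mem' := by
        rintro a _ ⟨t, rfl⟩
        exact ⟨t.smul a, rfl⟩ }
  -- The carrier is the image of `Term K G n p`, which lies in `Type u` whatever the universe of
  -- `I`.
  small n p := small_range (fun (t : Term K G n p) (i : I) => t.eval (S i) (v i))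
  d_mem := by
    rintro n p p' _ ⟨t, rfl⟩
    exact ⟨t.d p p', rfl⟩
  act_mem := by
    rintro n σ p _ ⟨t, rfl⟩
    exact ⟨t.act σ, rfl⟩
  coaug_mem n := ⟨Term.coaug, rfl⟩
  aug_eq := by
    rintro n p _ ⟨t, rfl⟩
    exact t.aug_eval S v hv

variable [Nonempty I]

/-- The generators of the `𝕊`-module `generated`. -/
noncomputable def gen {n : ℕ} {p : ℤ} (g : G n p) : (generated S v hv).toSModule.El n p :=
  (generated S v hv).elem (fun i => v i n p g) ⟨Term.gen g, rfl⟩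

@[simp] lemma ev_proj_gen (i : I) {n : ℕ} {p : ℤ} (g : G n p) :
    DGAModule.ev (Hom.app ((generated S v hv).proj i) n) p (gen S v hv g) = v i n p g :=
  (generated S v hv).ev_proj_elem (fun i => v i n p g) _ i

/-- An expression `t` whose values in the factors are the components of `x` also has value `x` in
the submodule, since the projections commute with evaluation and are jointly injective. -/
lemma exists_eval_eq {n : ℕ} {p : ℤ} (x : (generated S v hv).toSModule.El n p) :
    ∃ t : Term K G n p, t.eval _ (fun _ _ g => gen S v hv g) = x := by
  obtain ⟨t, ht⟩ := proj_mem x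
  refine ⟨t, ext_proj fun i => ?_⟩
  rw [Term.ev_eval]
  simp only [ev_proj_gen]
  exact congrFun ht i

lemma generated_hom_ext {N : SModule K} {f g : (generated S v hv).toSModule ⟶ N}
    (h : ∀ n p (x : G n p), DGAModule.ev (Hom.app f n) p (gen S v hv x) =
      DGAModule.ev (Hom.app g n) p (gen S v hv x)) : f = g := by
  refine hom_ext_ev fun n p x => ?_
  obtain ⟨t, rfl⟩ := exists_eval_eq S v hv x
  rw [Term.ev_eval, Term.ev_eval]
  simp only [h]

end SmallSub

section Colimits

variable {J : Type u} [SmallCategory J] (D : J ⥤ SModule K)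

/-- The augmentations form a cocone because the morphisms of the diagram preserve them. -/
instance : Nonempty (Cocone D) :=
  ⟨{ pt := ground K
     ι := { app := fun j => (D.obj j).augHom
            naturality := fun _ _ f => hom_ext_ev fun n p x =>
              congrArg (DGAModule.groundIncl K p) (DGAModule.aug_ev (Hom.app (D.map f) n) p x) } }⟩

/-- The subobject of the product of the vertices of all cocones generated by the diagram. -/
def colimitSub : SmallSub (fun c : Cocone D => c.pt) :=
  SmallSub.generated (fun c : Cocone D => c.pt) (G := fun n p => Σ j, (D.obj j).El n p)
    (fun c n p g => DGAModule.ev (Hom.app (c.ι.app g.1) n) p g.2)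
    (fun n p g c c' => (DGAModule.aug_ev (Hom.app (c.ι.app g.1) n) p g.2).trans
      (DGAModule.aug_ev (Hom.app (c'.ι.app g.1) n) p g.2).symm)

/-- The morphisms from the objects of the diagram to the subobject that they generate. -/
noncomputable def colimitι (j : J) : D.obj j ⟶ (colimitSub D).toSModule :=
  (colimitSub D).lift (fun c => c.ι.app j) (fun _ _ x => ⟨Term.gen ⟨j, x⟩, rfl⟩)

lemma colimitι_proj (j : J) (c : Cocone D) :
    colimitι D j ≫ (colimitSub D).proj c = c.ι.app j :=
  (colimitSub D).lift_proj _ _ c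

lemma map_colimitι {j k : J} (f : j ⟶ k) : D.map f ≫ colimitι D k = colimitι D j := by
  refine SmallSub.hom_ext_proj _ fun c => ?_
  rw [Category.assoc, colimitι_proj, colimitι_proj]
  exact c.w f

/-- The colimit cocone of a diagram of `𝕊`-modules. -/
noncomputable def colimitCocone : Cocone D where
  pt := (colimitSub D).toSModule
  ι :=
    { app := colimitι D
      naturality := fun _ _ f => (map_colimitι D f).trans (Category.comp_id _).symm }

/-- The cocone `colimitCocone` is a colimit cocone. -/
noncomputable def colimitCoconeIsColimit : IsColimit (colimitCocone D) where
  desc c := (colimitSub D).proj c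
  fac c j := colimitι_proj D j c
  uniq c _ hm := SmallSub.generated_hom_ext _ _ _ fun n p ⟨j, x⟩ =>
    congrArg (fun g => DGAModule.ev (Hom.app g n) p x) ((hm j).trans (colimitι_proj D j c).symm)

instance : HasColimitsOfSize.{u, u} (SModule K) where
  has_colimits_of_shape _ _ := { has_colimit := fun D => ⟨⟨_, colimitCoconeIsColimit D⟩⟩ }

end Colimits

end SModule

/-! ### Coaugmentations as morphisms from the ground field. -/

namespace DGAModule

variable {K : Type u} [Field K] (M : DGAModule K)

/-- The coaugmentation of a DGA-module, extended by zero to all degrees. -/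
noncomputable def coaugIncl (p : ℤ) : K →ₗ[K] M.cx.X p :=
  if h : p = 0 then h ▸ M.coaug else 0

lemma coaugIncl_zero : M.coaugIncl 0 = M.coaug := by
  simp [coaugIncl]

/-- The coaugmentation, as a morphism of DGA-modules. -/
noncomputable def coaugHom : ground K ⟶ M where
  f :=
    { f := fun p => ModuleCat.ofHom (M.coaugIncl p ∘ₗ (ground K).aug p)
      comm' := by
        intro p p' _
        refine ModuleCat.hom_ext (LinearMap.ext fun x => ?_)
        have h : M.coaugIncl p' ((ground K).aug p' (((ground K).cx.d p p').hom x)) = 0 := by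
          rw [aug_d, map_zero]
        refine Eq.trans ?_ h.symm
        change (M.cx.d p p').hom (M.coaugIncl p ((ground K).aug p x)) = 0
        by_cases hp : p = 0
        · subst hp
          rw [coaugIncl_zero, d_coaug]
        · rw [aug_apply_eq_zero _ hp, map_zero, map_zero] }
  aug_comp p x := by
    change M.aug p (M.coaugIncl p ((ground K).aug p x)) = _
    by_cases hp : p = 0
    · subst hp
      rw [coaugIncl_zero, aug_coaug]
    · rw [aug_apply_eq_zero _ hp, aug_apply_eq_zero _ hp]
  comp_coaug a := by
    change M.coaugIncl 0 ((ground K).aug 0 ((ground K).coaug a)) = _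
    rw [coaugIncl_zero, aug_coaug]

variable {M}

/-- Compatibility with coaugmentations leaves no choice in degree `0`, and the ground field vanishes
elsewhere. So the unit of an operad is forced to be the coaugmentation of `P(1)`, and preservation
of units by morphisms is automatic. -/
lemma ground_hom_ext (f g : ground K ⟶ M) : f = g := by
  refine hom_ext _ _ <| HomologicalComplex.hom_ext _ _ fun p =>
    ModuleCat.hom_ext (LinearMap.ext fun x => ?_)
  by_cases hp : p = 0
  · subst hp
    rw [← ground_aug_injective 0 (aug_coaug (ground K) ((ground K).aug 0 x))]
    exact (f.comp_coaug _).trans (g.comp_coaug _).symm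
  · obtain rfl : 0 = x := ground_aug_injective p (by
      rw [aug_apply_eq_zero _ hp, aug_apply_eq_zero _ hp])
    rw [map_zero, map_zero]

end DGAModule

lemma dAt_ev {K : Type u} [Field K] {h : ℕ} {B C : Fin h → DGAModule K} (f : ∀ k, B k ⟶ C k)
    {q : Fin h → ℤ} (y : ∀ k, (B k).cx.X (q k)) (j k : Fin h) :
    DGAModule.ev (f k) _ (dAt (fun k => (B k).cx) y j k) =
      dAt (fun k => (C k).cx) (fun k => DGAModule.ev (f k) (q k) (y k)) j k := by
  -- The target degree is made a variable so that the equality of degrees can be eliminated; in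
  -- `dAt` it is a value of `Function.update`.
  have H : ∀ {p p' : ℤ} (e : p = p') (x : (B k).cx.X p),
      DGAModule.ev (f k) p' (((B k).cx.XIsoOfEq e).hom.hom x) =
        ((C k).cx.XIsoOfEq e).hom.hom (DGAModule.ev (f k) p x) := by
    rintro p _ rfl x
    rfl
  unfold dAt
  split_ifs with hk
  · exact DGAModule.ev_d (f k) _ _ _
  · exact H _ _

/-! ### Small suboperads of large products. -/

namespace DGAOperad

variable {K : Type u} [Field K]

section SmallSub

open SModule SModule.SmallSub

variable {I : Type w} {P : I → DGAOperad K} (W : SmallSub (fun a => (P a).toSModule))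

/-- The property of being closed under the compositions. -/
def CompClosed : Prop :=
  ∀ {h n : ℕ} (i : Fin h → ℕ) (hn : ∑ j, i j = n) (p : ℤ) (q : Fin h → ℤ) (t : ℤ)
    (ht : p + ∑ k, q k = t) (x : ∀ a, (P a).El h p) (y : ∀ k a, (P a).El (i k) (q k)),
    x ∈ W.carrier h p → (∀ k, y k ∈ W.carrier (i k) (q k)) →
    (fun a => ((P a).comp i hn).toFun p q t ht (x a) (fun k => y k a)) ∈ W.carrier n t

variable {W} (hc : CompClosed W) [hI : Nonempty I]

/-- The composition of elements of a small suboperad. -/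
noncomputable def compEl {h n : ℕ} (i : Fin h → ℕ) (hn : ∑ j, i j = n)
    (p : ℤ) (q : Fin h → ℤ) (t : ℤ) (ht : p + ∑ k, q k = t) (x : W.toSModule.El h p)
    (y : ∀ k, W.toSModule.El (i k) (q k)) : W.toSModule.El n t :=
  W.elem (fun a => ((P a).comp i hn).toFun p q t ht (DGAModule.ev (Hom.app (W.proj a) h) p x)
      (fun k => DGAModule.ev (Hom.app (W.proj a) (i k)) (q k) (y k)))
    (hc i hn p q t ht _ _ (proj_mem x) (fun k => proj_mem (y k)))

lemma ev_proj_compEl {h n : ℕ} (i : Fin h → ℕ) (hn : ∑ j, i j = n)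
    (p : ℤ) (q : Fin h → ℤ) (t : ℤ) (ht : p + ∑ k, q k = t) (x : W.toSModule.El h p)
    (y : ∀ k, W.toSModule.El (i k) (q k)) (a : I) :
    DGAModule.ev (Hom.app (W.proj a) n) t (compEl hc i hn p q t ht x y) =
      ((P a).comp i hn).toFun p q t ht (DGAModule.ev (Hom.app (W.proj a) h) p x)
        (fun k => DGAModule.ev (Hom.app (W.proj a) (i k)) (q k) (y k)) :=
  W.ev_proj_elem (fun a => ((P a).comp i hn).toFun p q t ht
    (DGAModule.ev (Hom.app (W.proj a) h) p x)
    (fun k => DGAModule.ev (Hom.app (W.proj a) (i k)) (q k) (y k))) _ a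

/-- The decidability instance is arbitrary because the multilinearity fields of `MultilinearMap`
quantify over it. -/
lemma update_ev {M N : SModule K} (f : M ⟶ N) {h : ℕ} {i : Fin h → ℕ} {q : Fin h → ℤ}
    [DecidableEq (Fin h)] (y : ∀ k, M.El (i k) (q k)) (j : Fin h) (z : M.El (i j) (q j)) :
    (fun k => DGAModule.ev (Hom.app f (i k)) (q k) (Function.update y j z k)) =
      Function.update (fun k => DGAModule.ev (Hom.app f (i k)) (q k) (y k)) j
        (DGAModule.ev (Hom.app f (i j)) (q j) z) := by
  funext k
  exact Function.apply_update (fun k => DGAModule.ev (Hom.app f (i k)) (q k)) y j z k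

/-- The composition of a small suboperad, as a multilinear map. -/
noncomputable def compMultilinear {h n : ℕ} (i : Fin h → ℕ) (hn : ∑ j, i j = n)
    (p : ℤ) (q : Fin h → ℤ) (t : ℤ) (ht : p + ∑ k, q k = t) :
    W.toSModule.El h p →ₗ[K]
      MultilinearMap K (fun k => W.toSModule.El (i k) (q k)) (W.toSModule.El n t) where
  toFun x :=
    { toFun := compEl hc i hn p q t ht x
      map_update_add' := fun y j z z' => ext_proj fun a => by
        simp only [map_add, ev_proj_compEl, update_ev, MultilinearMap.map_update_add]
      map_update_smul' := fun y j c z => ext_proj fun a => by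
        simp only [map_smul, ev_proj_compEl, update_ev, MultilinearMap.map_update_smul] }
  map_add' x x' := MultilinearMap.ext fun y => ext_proj fun a => by
    refine (ev_proj_compEl hc i hn p q t ht (x + x') y a).trans ?_
    refine Eq.trans ?_ (map_add _ (compEl hc i hn p q t ht x y) _).symm
    refine Eq.trans ?_ (congrArg₂ _ (ev_proj_compEl hc i hn p q t ht x y a)
      (ev_proj_compEl hc i hn p q t ht x' y a)).symm
    rw [map_add, map_add]
    rfl
  map_smul' c x := MultilinearMap.ext fun y => ext_proj fun a => by
    refine (ev_proj_compEl hc i hn p q t ht (c • x) y a).trans ?_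
    refine Eq.trans ?_ (map_smul _ c (compEl hc i hn p q t ht x y)).symm
    refine Eq.trans ?_ (congrArg _ (ev_proj_compEl hc i hn p q t ht x y a)).symm
    rw [map_smul, map_smul]
    rfl

lemma ev_proj_compMultilinear {h n : ℕ} (i : Fin h → ℕ) (hn : ∑ j, i j = n)
    (p : ℤ) (q : Fin h → ℤ) (t : ℤ) (ht : p + ∑ k, q k = t) (x : W.toSModule.El h p)
    (y : ∀ k, W.toSModule.El (i k) (q k)) (a : I) :
    DGAModule.ev (Hom.app (W.proj a) n) t (compMultilinear hc i hn p q t ht x y) =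
      ((P a).comp i hn).toFun p q t ht (DGAModule.ev (Hom.app (W.proj a) h) p x)
        (fun k => DGAModule.ev (Hom.app (W.proj a) (i k)) (q k) (y k)) :=
  ev_proj_compEl hc i hn p q t ht x y a

/-- The composition of a small suboperad. -/
noncomputable def compHom {h n : ℕ} (i : Fin h → ℕ) (hn : ∑ j, i j = n) :
    TensorHom (W.toSModule.obj h) (fun j => W.toSModule.obj (i j)) (W.toSModule.obj n) where
  toFun := compMultilinear hc i hn
  map_d p q t ht x y := ext_proj fun a => by
    rw [DGAModule.ev_d, ev_proj_compMultilinear, map_add, map_sum, ev_proj_compMultilinear, DGAModule.ev_d,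
      ((P a).comp i hn).map_d]
    congr 1
    refine Finset.sum_congr rfl fun j _ => ?_
    rw [DGAModule.ev_units_smul, ev_proj_compMultilinear]
    congr 2
    funext k
    exact (dAt_ev (fun k => Hom.app (W.proj a) (i k)) y j k).symm
  map_aug p q t ht x y := by
    rw [← DGAModule.aug_ev (Hom.app (W.proj hI.some) n), ev_proj_compMultilinear,
      ((P hI.some).comp i hn).map_aug]
    simp only [DGAModule.aug_ev]
  map_coaug := ext_proj fun a => by
    rw [ev_proj_compMultilinear]
    simp only [DGAModule.ev_coaug]
    exact ((P a).comp i hn).map_coaug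

lemma ev_proj_compHom {h n : ℕ} (i : Fin h → ℕ) (hn : ∑ j, i j = n)
    (p : ℤ) (q : Fin h → ℤ) (t : ℤ) (ht : p + ∑ k, q k = t) (x : W.toSModule.El h p)
    (y : ∀ k, W.toSModule.El (i k) (q k)) (a : I) :
    DGAModule.ev (Hom.app (W.proj a) n) t ((compHom hc i hn).toFun p q t ht x y) =
      ((P a).comp i hn).toFun p q t ht (DGAModule.ev (Hom.app (W.proj a) h) p x)
        (fun k => DGAModule.ev (Hom.app (W.proj a) (i k)) (q k) (y k)) :=
  ev_proj_compMultilinear hc i hn p q t ht x y a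

/-- A small suboperad of a product, as an operad. -/
noncomputable def ofSmallSub : DGAOperad K where
  toSModule := W.toSModule
  -- The only possible unit, by `DGAModule.ground_hom_ext`; its image in each factor is therefore
  -- the unit of that factor.
  unit := DGAModule.coaugHom _
  comp := compHom hc
  assoc i hn r hm p t q s ht x y z := ext_proj fun a => by
    rw [DGAModule.ev_units_smul]
    simp only [ev_proj_compHom]
    exact (P a).assoc i hn r hm q s ht _ _
      (fun b c => DGAModule.ev (Hom.app (W.proj a) _) _ (z b c))
  comp_unit x := ext_proj fun a => by
    simp only [ev_proj_compHom, DGAModule.ev_coaug]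
    -- `ev_coaug` rewrites the unit element, here and in the goal, as the coaugmentation of `1` in
    -- `P(1)`.
    have := (P a).comp_unit (DGAModule.ev (Hom.app (W.proj a) _) _ x)
    rwa [DGAModule.ev_coaug] at this
  unit_comp y := ext_proj fun a => by
    simp only [ev_proj_compHom, DGAModule.ev_coaug]
    have := (P a).unit_comp (DGAModule.ev (Hom.app (W.proj a) _) _ y)
    rwa [DGAModule.ev_coaug] at this
  equivariant_left i hn σ p t q ht x y := ext_proj fun a => by
    rw [DGAModule.ev_units_smul, ev_ract]
    simp only [ev_proj_compHom, ev_ract]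
    exact (P a).equivariant_left i hn σ q ht _ (fun k => DGAModule.ev (Hom.app (W.proj a) _) _ (y k))
  equivariant_right i hn τ p t q ht x y := ext_proj fun a => by
    rw [ev_ract]
    simp only [ev_proj_compHom, ev_ract]
    exact (P a).equivariant_right i hn τ q ht _ _

/-- The projections from a small suboperad of a product to the factors. -/
noncomputable def ofSmallSubProj (a : I) : ofSmallSub hc ⟶ P a where
  toSHom := W.proj a
  map_unit := DGAModule.ground_hom_ext _ _
  map_comp i hn _ _ q ht x y := ev_proj_compHom hc i hn _ q _ ht x y a

/-- The morphism to a small suboperad of a product with given components. -/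
noncomputable def ofSmallSubLift {N : DGAOperad K} (f : ∀ a, N ⟶ P a)
    (hf : ∀ n p x, (fun a => DGAModule.ev (Hom.app (f a).toSHom n) p x) ∈ W.carrier n p) :
    N ⟶ ofSmallSub hc where
  toSHom := W.lift (fun a => (f a).toSHom) hf
  map_unit := DGAModule.ground_hom_ext _ _
  map_comp {h n} i hn p t q ht x y := ext_proj fun a => by
    refine (W.ev_proj_lift _ hf _ a).trans ?_
    refine ((f a).map_comp i hn q ht x y).trans ?_
    refine Eq.trans ?_ (ev_proj_compHom hc i hn _ q _ ht _ _ a).symm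
    exact congrArg₂ (fun x y => ((P a).comp i hn).toFun p q t ht x y)
      (W.ev_proj_lift _ hf x a).symm (funext fun k => (W.ev_proj_lift _ hf (y k) a).symm)

end SmallSub
end DGAOperad

/-! ### Generation by a small family, colimits of operads and free operads. -/

namespace DGAOperad

variable {K : Type u} [Field K]

/-- Formal expressions in generators, in the language of operads. -/
inductive Term (K : Type u) (G : ℕ → ℤ → Type u) : ℕ → ℤ → Type u
  | gen (n : ℕ) (p : ℤ) (g : G n p) : Term K G n p
  | zero (n : ℕ) (p : ℤ) : Term K G n p
  | add (n : ℕ) (p : ℤ) (s t : Term K G n p) : Term K G n p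
  | smul (n : ℕ) (p : ℤ) (a : K) (t : Term K G n p) : Term K G n p
  | d (n : ℕ) (p p' : ℤ) (t : Term K G n p) : Term K G n p'
  | act (n : ℕ) (p : ℤ) (σ : Equiv.Perm (Fin n)) (t : Term K G n p) : Term K G n p
  -- For `n = 1` this is the operad unit, which thus needs no constructor of its own.
  | coaug (n : ℕ) : Term K G n 0
  | comp (h n : ℕ) (i : Fin h → ℕ) (hn : ∑ j, i j = n) (p : ℤ) (q : Fin h → ℤ) (t : ℤ)
      (ht : p + ∑ k, q k = t) (x : Term K G h p) (y : ∀ k, Term K G (i k) (q k)) : Term K G n t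

/-- The value of a formal expression in an operad. -/
def Term.eval (P : DGAOperad K) {G : ℕ → ℤ → Type u} (v : ∀ n p, G n p → P.El n p) :
    ∀ {n : ℕ} {p : ℤ}, Term K G n p → P.El n p
  | _, _, gen _ _ g => v _ _ g
  | _, _, zero _ _ => 0
  | _, _, add _ _ s t => s.eval P v + t.eval P v
  | _, _, smul _ _ a t => a • t.eval P v
  | _, _, d n p p' t => ((P.obj n).cx.d p p').hom (t.eval P v)
  | _, _, act _ _ σ t => P.ract (t.eval P v) σ
  | _, _, coaug n => (P.obj n).coaug 1
  | _, _, comp _ _ i hn p q t ht x y =>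
      (P.comp i hn).toFun p q t ht (x.eval P v) (fun k => (y k).eval P v)

lemma Term.ev_eval {P Q : DGAOperad K} (f : P ⟶ Q) {G : ℕ → ℤ → Type u}
    (v : ∀ n p, G n p → P.El n p) {n : ℕ} {p : ℤ} (t : Term K G n p) :
    DGAModule.ev (SModule.Hom.app f.toSHom n) p (t.eval P v) =
      t.eval Q (fun n p g => DGAModule.ev (SModule.Hom.app f.toSHom n) p (v n p g)) := by
  induction t with
  | gen n p g => rfl
  | zero n p => exact map_zero _
  | add n p s t hs ht => rw [eval, map_add, hs, ht, eval]
  | smul n p a t ht => rw [eval, map_smul, ht, eval]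
  | d n p p' t ht => rw [eval, DGAModule.ev_d, ht, eval]
  | act n p σ t ht => rw [eval, SModule.ev_ract, ht, eval]
  | coaug n => exact DGAModule.ev_coaug _ 1
  | comp h n i hn p q t ht x y hx hy =>
    rw [eval, f.map_comp, hx, eval]
    simp only [hy]

variable {I : Type w} (P : I → DGAOperad K) {G : ℕ → ℤ → Type u}
  (v : ∀ a n p, G n p → (P a).El n p)
  (hv : ∀ n p g a b, ((P a).obj n).aug p (v a n p g) = ((P b).obj n).aug p (v b n p g))

include hv in
lemma Term.aug_eval {n : ℕ} {p : ℤ} (t : Term K G n p) (a b : I) :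
    ((P a).obj n).aug p (t.eval (P a) (v a)) = ((P b).obj n).aug p (t.eval (P b) (v b)) := by
  induction t with
  | gen n p g => exact hv _ _ g a b
  | zero n p => rw [eval, eval, map_zero, map_zero]
  | add n p s t hs ht => rw [eval, eval, map_add, map_add, hs, ht]
  | smul n p a t ht => rw [eval, eval, map_smul, map_smul, ht]
  | d n p p' t ht => rw [eval, eval, DGAModule.aug_d, DGAModule.aug_d]
  | act n p σ t ht => rw [eval, eval, SModule.aug_ract, SModule.aug_ract, ht]
  | coaug n => rw [eval, eval, DGAModule.aug_coaug, DGAModule.aug_coaug]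
  | comp h n i hn p q t ht x y hx hy =>
    rw [eval, eval, TensorHom.map_aug, TensorHom.map_aug, hx]
    simp only [hy]

/-- The small suboperad of a product generated by a small family of elements. -/
def generatedSub : SModule.SmallSub (fun a => (P a).toSModule) where
  carrier n p :=
    { carrier := Set.range fun (t : Term K G n p) (a : I) => t.eval (P a) (v a)
      add_mem' := by
        rintro _ _ ⟨s, rfl⟩ ⟨t, rfl⟩
        exact ⟨s.add _ _ t, rfl⟩
      zero_mem' := ⟨Term.zero n p, rfl⟩
      smul_mem' := by
        rintro a _ ⟨t, rfl⟩
        exact ⟨t.smul _ _ a, rfl⟩ }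
  small n p := small_range (fun (t : Term K G n p) (a : I) => t.eval (P a) (v a))
  d_mem := by
    rintro n p p' _ ⟨t, rfl⟩
    exact ⟨t.d n p p', rfl⟩
  act_mem := by
    rintro n σ p _ ⟨t, rfl⟩
    exact ⟨t.act n p σ, rfl⟩
  coaug_mem n := ⟨Term.coaug n, rfl⟩
  aug_eq := by
    rintro n p _ ⟨t, rfl⟩
    exact t.aug_eval P v hv

lemma generatedSub_compClosed : CompClosed (generatedSub P v hv) := by
  rintro h n i hn p q t ht _ y ⟨x, rfl⟩ hy
  -- An expression is chosen for each argument; one expression gives all the components of that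
  -- argument at once.
  choose y' hy' using hy
  obtain rfl : (fun k a => (y' k).eval (P a) (v a)) = y := funext hy'
  exact ⟨Term.comp h n i hn p q t ht x y', rfl⟩

variable [Nonempty I]

/-- The operad generated by a small family of elements of a product of operads. -/
noncomputable def generated : DGAOperad K :=
  ofSmallSub (generatedSub_compClosed P v hv)

/-- The projections from the operad `generated` to the factors. -/
noncomputable def generatedProj (a : I) : generated P v hv ⟶ P a :=
  ofSmallSubProj (generatedSub_compClosed P v hv) a

/-- The generators of the operad `generated`. -/
noncomputable def gen {n : ℕ} {p : ℤ} (g : G n p) : (generated P v hv).El n p :=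
  (generatedSub P v hv).elem (fun a => v a n p g) ⟨Term.gen _ _ g, rfl⟩

@[simp] lemma ev_generatedProj_gen (a : I) {n : ℕ} {p : ℤ} (g : G n p) :
    DGAModule.ev (SModule.Hom.app (generatedProj P v hv a).toSHom n) p (gen P v hv g) =
      v a n p g :=
  (generatedSub P v hv).ev_proj_elem (fun a => v a n p g) _ a

lemma exists_eval_eq {n : ℕ} {p : ℤ} (x : (generated P v hv).El n p) :
    ∃ t : Term K G n p, t.eval _ (fun _ _ g => gen P v hv g) = x := by
  obtain ⟨t, ht⟩ := SModule.SmallSub.proj_mem (W := generatedSub P v hv) x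
  refine ⟨t, SModule.SmallSub.ext_proj fun a => ?_⟩
  refine (Term.ev_eval (generatedProj P v hv a) _ t).trans ?_
  simp only [ev_generatedProj_gen]
  exact congrFun ht a

lemma hom_ext_ev {P Q : DGAOperad K} {f g : P ⟶ Q}
    (h : ∀ n p x, DGAModule.ev (SModule.Hom.app f.toSHom n) p x =
      DGAModule.ev (SModule.Hom.app g.toSHom n) p x) : f = g :=
  Hom.ext (SModule.hom_ext_ev h)

lemma generated_hom_ext {N : DGAOperad K} {f g : generated P v hv ⟶ N}
    (h : ∀ n p (x : G n p), DGAModule.ev (SModule.Hom.app f.toSHom n) p (gen P v hv x) =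
      DGAModule.ev (SModule.Hom.app g.toSHom n) p (gen P v hv x)) : f = g := by
  refine hom_ext_ev fun n p x => ?_
  obtain ⟨t, rfl⟩ := exists_eval_eq P v hv x
  rw [Term.ev_eval, Term.ev_eval]
  simp only [h]

section Colimits

variable {J : Type u} [SmallCategory J] (D : J ⥤ DGAOperad K)

instance : Nonempty (Cocone D) :=
  ⟨{ pt := commutative K
     ι := { app := fun j => (D.obj j).augHom
            naturality := fun _ _ f => hom_ext_ev fun n p x =>
              congrArg (DGAModule.groundIncl K p)
                (DGAModule.aug_ev (SModule.Hom.app (D.map f).toSHom n) p x) } }⟩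

lemma aug_cocone (n : ℕ) (p : ℤ) (g : Σ j, (D.obj j).El n p) (c c' : Cocone D) :
    (c.pt.obj n).aug p (DGAModule.ev (SModule.Hom.app (c.ι.app g.1).toSHom n) p g.2) =
      (c'.pt.obj n).aug p (DGAModule.ev (SModule.Hom.app (c'.ι.app g.1).toSHom n) p g.2) :=
  (DGAModule.aug_ev (SModule.Hom.app (c.ι.app g.1).toSHom n) p g.2).trans
    (DGAModule.aug_ev (SModule.Hom.app (c'.ι.app g.1).toSHom n) p g.2).symm

/-- The suboperad, generated by the diagram, of the product of the vertices of all cocones. -/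
noncomputable def colimitOperad : DGAOperad K :=
  generated (fun c : Cocone D => c.pt) _ (aug_cocone D)

/-- The projections from `colimitOperad` to the vertices of all cocones. -/
noncomputable def colimitDesc (c : Cocone D) : colimitOperad D ⟶ c.pt :=
  generatedProj (fun c : Cocone D => c.pt) _ (aug_cocone D) c

/-- The morphisms from the objects of the diagram to the operad that they generate. -/
noncomputable def colimitι (j : J) : D.obj j ⟶ colimitOperad D :=
  ofSmallSubLift (generatedSub_compClosed (fun c : Cocone D => c.pt) _ (aug_cocone D))
    (fun c => c.ι.app j) (fun _ _ x => ⟨Term.gen _ _ ⟨j, x⟩, rfl⟩)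

lemma colimitι_desc (j : J) (c : Cocone D) : colimitι D j ≫ colimitDesc D c = c.ι.app j :=
  Hom.ext (SModule.SmallSub.lift_proj _ _ _ c)

lemma map_colimitι {j k : J} (f : j ⟶ k) : D.map f ≫ colimitι D k = colimitι D j := by
  refine Hom.ext (SModule.SmallSub.hom_ext_proj _ fun c => ?_)
  refine congrArg Hom.toSHom (?_ : (D.map f ≫ colimitι D k) ≫ colimitDesc D c =
    colimitι D j ≫ colimitDesc D c)
  rw [Category.assoc, colimitι_desc, colimitι_desc]
  exact c.w f

/-- The colimit cocone of a diagram of operads. -/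
noncomputable def colimitCocone : Cocone D where
  pt := colimitOperad D
  ι :=
    { app := colimitι D
      naturality := fun _ _ f => (map_colimitι D f).trans (Category.comp_id _).symm }

/-- The cocone `colimitCocone` is a colimit cocone. -/
noncomputable def colimitCoconeIsColimit : IsColimit (colimitCocone D) where
  desc c := colimitDesc D c
  fac c j := colimitι_desc D j c
  uniq c _ hm := generated_hom_ext _ _ _ fun n p ⟨j, x⟩ =>
    congrArg (fun g : D.obj j ⟶ c.pt => DGAModule.ev (SModule.Hom.app g.toSHom n) p x)
      ((hm j).trans (colimitι_desc D j c).symm)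

instance : HasColimitsOfSize.{u, u} (DGAOperad K) where
  has_colimits_of_shape _ _ := { has_colimit := fun D => ⟨⟨_, colimitCoconeIsColimit D⟩⟩ }

end Colimits

section Free

variable (M : SModule K)

/-- The commutative operad has the terminal `𝕊`-module underneath, so every `𝕊`-module maps to it by
its augmentations. -/
instance : Nonempty (StructuredArrow M (forget K)) :=
  ⟨StructuredArrow.mk (Y := commutative K) M.augHom⟩

lemma aug_structuredArrow (n : ℕ) (p : ℤ) (x : M.El n p) (a b : StructuredArrow M (forget K)) :
    (a.right.obj n).aug p (DGAModule.ev (SModule.Hom.app a.hom n) p x) =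
      (b.right.obj n).aug p (DGAModule.ev (SModule.Hom.app b.hom n) p x) :=
  (DGAModule.aug_ev (SModule.Hom.app a.hom n) p x).trans
    (DGAModule.aug_ev (SModule.Hom.app b.hom n) p x).symm

/-- The free operad on an `𝕊`-module, with the inclusion of the generators. -/
noncomputable def free : StructuredArrow M (forget K) :=
  StructuredArrow.mk
    (Y := generated (fun a : StructuredArrow M (forget K) => a.right) _ (aug_structuredArrow M))
    ((generatedSub (fun a : StructuredArrow M (forget K) => a.right) _
      (aug_structuredArrow M)).lift (fun a => a.hom) (fun _ _ x => ⟨Term.gen _ _ x, rfl⟩))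

/-- The free operad on an `𝕊`-module is initial. -/
noncomputable def freeIsInitial : IsInitial (free M) :=
  IsInitial.ofUniqueHom
    (fun a => StructuredArrow.homMk
      (generatedProj (fun a : StructuredArrow M (forget K) => a.right) _
        (aug_structuredArrow M) a)
      (SModule.SmallSub.lift_proj _ _ _ a))
    (fun a m => StructuredArrow.hom_ext _ _ (generated_hom_ext _ _ _ fun n p x => by
      refine (congrArg (fun g : M ⟶ a.right.toSModule => DGAModule.ev (SModule.Hom.app g n) p x)
        (StructuredArrow.w m)).trans ?_
      exact (ev_generatedProj_gen (fun a : StructuredArrow M (forget K) => a.right) _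
        (aug_structuredArrow M) a x).symm))

/-- A left adjoint exists as soon as each category of arrows `M ⟶ U P` has an initial object. -/
lemma forget_isRightAdjoint : (forget K).IsRightAdjoint :=
  have (M : SModule K) : HasInitial (StructuredArrow M (forget K)) := (freeIsInitial M).hasInitial
  isRightAdjointOfStructuredArrowInitials _

end Free

end DGAOperad

/-! ### The reflexive pair of an adjunction and its coequalizers. -/

namespace ReflexivePairOfAdj

variable {J : Type u} [SmallCategory J] {C : Type u₁} [Category.{v₁} C] {D : Type u₂}
  [Category.{v₂} D] {F : C ⥤ D} {U : D ⥤ C} (adj : F ⊣ U) {P : J ⥤ D}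
  {A : Cocone (P ⋙ U)} {B : Cocone (((P ⋙ U) ⋙ F) ⋙ U)}

lemma ι_homEquiv_d₀ (hB : IsColimit B) (j : J) :
    B.ι.app j ≫ adj.homEquiv B.pt (F.obj A.pt) (d₀ adj hB) = U.map (F.map (A.ι.app j)) :=
  (congrArg (B.ι.app j ≫ ·) ((adj.homEquiv B.pt (F.obj A.pt)).apply_symm_apply _)).trans
    (hB.fac _ j)

lemma ι_homEquiv_d₁ (hB : IsColimit B) (j : J) :
    B.ι.app j ≫ adj.homEquiv B.pt (F.obj A.pt) (d₁ adj hB) =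
      U.map (adj.counit.app (P.obj j)) ≫ A.ι.app j ≫ adj.unit.app A.pt :=
  (congrArg (B.ι.app j ≫ ·) ((adj.homEquiv B.pt (F.obj A.pt)).apply_symm_apply _)).trans
    (hB.fac _ j)

/-- Passing to adjoints turns the identity into one between morphisms out of a colimit, checked on
components. For `d₀` the hypothesis is naturality of the unit, for `d₁` a triangle identity. -/
lemma s_comp_eq_id (hA : IsColimit A) (d : F.obj B.pt ⟶ F.obj A.pt)
    (h : ∀ j, adj.unit.app (U.obj (P.obj j)) ≫ B.ι.app j ≫ adj.homEquiv B.pt (F.obj A.pt) d =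
      A.ι.app j ≫ adj.unit.app A.pt) :
    s adj (B := B) hA ≫ d = 𝟙 (F.obj A.pt) := by
  apply (adj.homEquiv _ _).injective
  refine (adj.homEquiv_naturality_left (hA.desc (unitCocone adj B) : A.pt ⟶ B.pt) d).trans ?_
  rw [adj.homEquiv_id]
  refine hA.hom_ext fun j => ?_
  rw [← Category.assoc, hA.fac, ← h, ← Category.assoc]
  rfl

lemma s_d₀ (hA : IsColimit A) (hB : IsColimit B) :
    s adj (B := B) hA ≫ d₀ adj hB = 𝟙 (F.obj A.pt) :=
  s_comp_eq_id adj hA _ fun j => by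
    rw [ι_homEquiv_d₀]
    exact (adj.unit.naturality (A.ι.app j)).symm

lemma s_d₁ (hA : IsColimit A) (hB : IsColimit B) :
    s adj (B := B) hA ≫ d₁ adj hB = 𝟙 (F.obj A.pt) :=
  s_comp_eq_id adj hA _ fun j => by
    rw [ι_homEquiv_d₁]
    exact adj.right_triangle_components_assoc _ _

/-- Read from right to left, the components of the adjoint of `π` precomposed with the counit
underlie morphisms of `D`; this is the form in which the equation is used to lift those components
to `D`. -/
lemma d₀_comp_eq_d₁_comp_iff (hB : IsColimit B) {Q : D} (π : F.obj A.pt ⟶ Q) :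
    d₀ adj hB ≫ π = d₁ adj hB ≫ π ↔ ∀ j,
      U.map (F.map (A.ι.app j) ≫ π) = U.map (adj.counit.app (P.obj j)) ≫
        A.ι.app j ≫ adj.homEquiv A.pt Q π := by
  rw [← (adj.homEquiv _ _).apply_eq_iff_eq, adj.homEquiv_naturality_right,
    adj.homEquiv_naturality_right]
  have h₀ (j : J) : B.ι.app j ≫ adj.homEquiv B.pt (F.obj A.pt) (d₀ adj hB) ≫ U.map π =
      U.map (F.map (A.ι.app j) ≫ π) := by
    rw [← Category.assoc, ι_homEquiv_d₀, U.map_comp]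
  have h₁ (j : J) : B.ι.app j ≫ adj.homEquiv B.pt (F.obj A.pt) (d₁ adj hB) ≫ U.map π =
      U.map (adj.counit.app (P.obj j)) ≫ A.ι.app j ≫ adj.homEquiv A.pt Q π := by
    rw [← Category.assoc, ι_homEquiv_d₁, adj.homEquiv_unit, Category.assoc, Category.assoc]
  constructor
  · intro h j
    rw [← h₀, h, h₁]
  · intro h
    exact hB.hom_ext fun j => by rw [h₀, h, h₁]

/-- If the morphisms `U P ⟶ U Q` compatible with the counits come from morphisms `P ⟶ Q`, then
a coequalizer of `d₀` and `d₁` is a colimit of the diagram. -/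
lemma exists_isColimit [U.Faithful]
    (hU : ∀ {X Y : D} (g : U.obj X ⟶ U.obj Y) (h : F.obj (U.obj X) ⟶ Y),
      U.map (adj.counit.app X) ≫ g = U.map h → ∃ f : X ⟶ Y, U.map f = g)
    (hA : IsColimit A) (hB : IsColimit B) (c : Cofork (d₀ adj (A := A) hB) (d₁ adj (A := A) hB))
    (hc : IsColimit c) :
    ∃ f : P ⟶ (Functor.const J).obj c.pt,
      (∀ j : J, U.map (f.app j) = A.ι.app j ≫ adj.unit.app A.pt ≫ U.map c.π) ∧
      Nonempty (IsColimit (Cocone.mk c.pt f)) := by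
  have hπ := (d₀_comp_eq_d₁_comp_iff adj hB c.π).1 c.condition
  -- The cocone: each component of the adjoint of `c.π` lifts to `D`, with `F (α_j) ≫ c.π` as the
  -- witness required by `hU`.
  choose f hf using fun j => hU _ _ (hπ j).symm
  have hnat {j k : J} (φ : j ⟶ k) : P.map φ ≫ f k = f j := by
    apply U.map_injective
    rw [U.map_comp, hf, hf, ← Category.assoc]
    exact congrArg (· ≫ _) (A.w φ)
  refine ⟨{ app := f, naturality := fun j k φ => (hnat φ).trans (Category.comp_id _).symm },
    fun j => (hf j).trans (by rw [adj.homEquiv_unit]), ⟨?_⟩⟩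
  let a (t : Cocone P) : A.pt ⟶ U.obj t.pt := hA.desc (U.mapCocone t)
  have ha (t : Cocone P) (j : J) : A.ι.app j ≫ a t = U.map (t.ι.app j) := hA.fac _ j
  -- Conversely, a cocone in `D` gives a morphism that coequalizes the pair, by naturality of the
  -- counit at its legs.
  have hd (t : Cocone P) : d₀ adj hB ≫ (adj.homEquiv A.pt t.pt).symm (a t) =
      d₁ adj hB ≫ (adj.homEquiv A.pt t.pt).symm (a t) := by
    rw [d₀_comp_eq_d₁_comp_iff]
    intro j
    have h : F.map (A.ι.app j) ≫ (adj.homEquiv A.pt t.pt).symm (a t) =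
        (adj.homEquiv _ _).symm (A.ι.app j ≫ a t) :=
      (adj.homEquiv_naturality_left_symm (A.ι.app j) (a t)).symm
    rw [Equiv.apply_symm_apply, h, ha, ← U.map_comp]
    refine congrArg U.map ((adj.homEquiv_counit ..).trans ?_)
    exact adj.counit.naturality (t.ι.app j)
  have hdesc (t : Cocone P) : c.π ≫ hc.desc (Cofork.ofπ _ (hd t)) =
      (adj.homEquiv A.pt t.pt).symm (a t) :=
    hc.fac (Cofork.ofπ _ (hd t)) WalkingParallelPair.one
  -- Translates between `c.π ≫ m` and the composites `f j ≫ m`, so that factorization and uniqueness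
  -- both pass from the cofork to the cocone.
  have hcomp (t : Cocone P) (m : c.pt ⟶ t.pt) (j : J) :
      A.ι.app j ≫ adj.homEquiv A.pt t.pt (c.π ≫ m) = U.map (f j ≫ m) := by
    rw [U.map_comp, hf, Category.assoc]
    exact congrArg (A.ι.app j ≫ ·) (adj.homEquiv_naturality_right c.π m)
  exact
    { desc := fun t => hc.desc (Cofork.ofπ _ (hd t))
      fac := fun t j => U.map_injective ((hcomp t _ j).symm.trans (by
        rw [hdesc, Equiv.apply_symm_apply, ha]))
      uniq := fun t m hm => Cofork.IsColimit.hom_ext hc (by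
        rw [hdesc, Equiv.eq_symm_apply]
        exact hA.hom_ext fun j => (hcomp t m j).trans
          ((congrArg U.map (hm j)).trans (ha t j).symm)) }

end ReflexivePairOfAdj

/-! ### Descent of operad morphisms along the counit, and the main theorem. -/

namespace DGAOperad

variable {K : Type u} [Field K]

instance : (forget K).Faithful where
  map_injective h := Hom.ext h

/-- Every composition in `P` is the image of one in `R`, where `e` followed by `g` is known to
preserve compositions. -/
lemma exists_hom_of_surjective {R P Q : DGAOperad K} (e : R ⟶ P) (h : R ⟶ Q)
    (he : ∀ n p, Function.Surjective (DGAModule.ev (SModule.Hom.app e.toSHom n) p))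
    (g : P.toSModule ⟶ Q.toSModule) (hg : e.toSHom ≫ g = h.toSHom) :
    ∃ f : P ⟶ Q, f.toSHom = g := by
  have H (n : ℕ) (p : ℤ) (x : R.El n p) : DGAModule.ev (SModule.Hom.app g n) p
      (DGAModule.ev (SModule.Hom.app e.toSHom n) p x) =
        DGAModule.ev (SModule.Hom.app h.toSHom n) p x :=
    congrArg (fun k : R.toSModule ⟶ Q.toSModule => DGAModule.ev (SModule.Hom.app k n) p x) hg
  refine ⟨{ toSHom := g, map_unit := DGAModule.ground_hom_ext _ _, map_comp := ?_ }, rfl⟩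
  intro m n i hn p t q ht x y
  obtain ⟨x, rfl⟩ := he _ _ x
  choose y' hy' using fun j => he _ _ (y j)
  obtain rfl := funext hy'
  rw [← e.map_comp]
  simp only [H]
  exact h.map_comp i hn q ht x y'

lemma exists_hom_of_counit {F : SModule K ⥤ DGAOperad K} (adj : F ⊣ forget K)
    {P Q : DGAOperad K} (g : (forget K).obj P ⟶ (forget K).obj Q)
    (h : F.obj ((forget K).obj P) ⟶ Q)
    (hg : (forget K).map (adj.counit.app P) ≫ g = (forget K).map h) :
    ∃ f : P ⟶ Q, (forget K).map f = g :=
  exists_hom_of_surjective (adj.counit.app P) h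
    -- The unit of the adjunction supplies preimages under the counit, by the triangle identity.
    (fun n p x => ⟨DGAModule.ev (SModule.Hom.app (adj.unit.app P.toSModule) n) p x,
      congrArg (fun k : P.toSModule ⟶ P.toSModule => DGAModule.ev (SModule.Hom.app k n) p x)
        (adj.right_triangle_components P)⟩) g hg

end DGAOperad

theorem mainTheorem1 (K : Type u) [Field K] :
    -- all small colimits exist in the category of operads
    HasColimitsOfSize.{u, u} (DGAOperad K) ∧
    -- small colimits of `𝕊`-modules and free operads exist
    HasColimitsOfSize.{u, u} (SModule K) ∧
    (DGAOperad.forget K).IsRightAdjoint ∧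
    -- the reflexive coequalizer of the pair `d₀, d₁` exists and is the colimit of the operads
    ∀ (F : SModule K ⥤ DGAOperad K) (adj : F ⊣ DGAOperad.forget K)
      (J : Type u) [SmallCategory J] (P : J ⥤ DGAOperad K)
      (A : Cocone (P ⋙ DGAOperad.forget K)) (hA : IsColimit A)
      (B : Cocone (((P ⋙ DGAOperad.forget K) ⋙ F) ⋙ DGAOperad.forget K)) (hB : IsColimit B),
      ReflexivePairOfAdj.s adj (B := B) hA ≫ ReflexivePairOfAdj.d₀ adj hB = 𝟙 (F.obj A.pt) ∧
      ReflexivePairOfAdj.s adj (B := B) hA ≫ ReflexivePairOfAdj.d₁ adj hB = 𝟙 (F.obj A.pt) ∧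
      HasCoequalizer (ReflexivePairOfAdj.d₀ adj (A := A) hB)
        (ReflexivePairOfAdj.d₁ adj (A := A) hB) ∧
      ∀ (c : Cofork (ReflexivePairOfAdj.d₀ adj (A := A) hB)
          (ReflexivePairOfAdj.d₁ adj (A := A) hB)), IsColimit c →
        ∃ f : P ⟶ (Functor.const J).obj c.pt,
          (∀ j : J, (DGAOperad.forget K).map (f.app j) =
            A.ι.app j ≫ adj.unit.app A.pt ≫ (DGAOperad.forget K).map c.π) ∧
          Nonempty (IsColimit (Cocone.mk c.pt f)) := by
  refine ⟨inferInstance, inferInstance, DGAOperad.forget_isRightAdjoint, ?_⟩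
  intro F adj J _ P A hA B hB
  exact ⟨ReflexivePairOfAdj.s_d₀ adj hA hB, ReflexivePairOfAdj.s_d₁ adj hA hB, inferInstance,
    ReflexivePairOfAdj.exists_isColimit adj
      (fun g h hg => DGAOperad.exists_hom_of_counit adj g h hg) hA hB⟩
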